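/- **Model.** The Earth is a sphere of radius $R_\oplus>0$ centred at the origin. There are $K$ tiers of satellites, tier $k$ consisting of $N_k\ge 1$ satellites at altitude $a_k>0$, and $R_k=a_k+R_\oplus$. Fix the legitimate tier $m$. The $N_m$ satellites of tier $m$ are i.i.d. uniform on the sphere of radius $R_m$. The typical device sits at $(0,0,R_\oplus)$; the other devices form a homogeneous Poisson point process with density $\lambda_u>0$ per unit of area on the sphere of radius $R_\oplus$. Let $\theta_{\rm beam}>0$ be the half beamwidth and $$\theta_{m,\max}=\begin{cases}\sin^{-1}\!\big(\tfrac{R_m}{R_\oplus}\sin\theta_{\rm beam}\big)-\theta_{\rm beam}, & \theta_{\rm beam}<\sin^{-1}(R_\oplus/R_m),\\ \cos^{-1}(R_\oplus/R_m), & \text{otherwise.}\end{cases}$$ A satellite of tier $m$ receives from a device at distance $d$, seen at central angle $\theta$, the power $P_{\rm rec}=P_t\big(\frac{c}{4\pi f d}\big)^2G\,|h|^2$ if $\theta<\theta_{m,\max}$, and $0$ otherwise (the device is then outside the main lobe or the line of sight); here $P_t,G,c,f>0$, and $|h|^2$ is the small-scale fading power of the link. The fading powers on the links from the devices to the serving satellite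 are independent; those of the interfering devices are Gamma distributed with integer shape $m_1\ge1$ and scale $m_2>0$, and that of the typical device has an arbitrary law with distribution function $F$. Satellites, devices and fading are mutually independent. The typical device is served by its nearest satellite of tier $m$, with $$\mathrm{SINR}_{\rm LS}=\frac{\gamma P_{{\rm rec},0}}{\mathcal I_m+\sigma_S^2},$$ where $\gamma\in(0,1]$ is the information-bearing ratio, $P_{{\rm rec},0}$ is the power received from the typical device, $\mathcal I_m$ is the sum of the powers received from all other devices, and $\sigma_S^2=N_0B>0$. For $\beta_{\rm LS}>0$ let $\mathcal P_{m,\rm cov}=\mathbb P[\mathrm{SINR}_{\rm LS}>\beta_{\rm LS}]$. **Notation.** Put $d(\theta)=\sqrt{R_\oplus^2+R_m^2-2R_\oplus R_m\cos\theta}$, $$f_{\theta_{m,0}}(\theta)=\tfrac{N_m\sin\theta}{2}\Big(\tfrac{1+\cos\theta}{2}\Big)^{N_m-1},\qquad \mathcal P_{m,\rm av}=1-\Big(\tfrac{1+\cos\theta_{m,\max}}{2}\Big)^{N_m},$$ $$\mathcal L_{\mathcal I_m}(s)=\exp\Big(-\lambda_u\int_0^{2\pi}\!\!\int_0^{\theta_{m,\max}}\Big[1-\Big(1+m_2sP_tG\big(\tfrac{c}{4\pi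 f d(\theta)}\big)^2\Big)^{-m_1}\Big]R_\oplus^2\sin\theta\,d\theta\,d\varphi\Big),$$ $$\kappa=\frac{(m_1!)^{-1/m_1}}{m_2},\qquad s_{\rm LS}(\theta)=\kappa\,\frac{\beta_{\rm LS}}{\gamma P_tG}\Big(\frac{4\pi f\,d(\theta)}{c}\Big)^2,\qquad A(x)=\big[1-e^{-\kappa x}\big]^{m_1},$$ $$Q=\sum_{q=1}^{m_1}\binom{m_1}{q}(-1)^{q+1}\int_0^{\theta_{m,\max}}\exp\!\big(-q\,s_{\rm LS}(\theta)\sigma_S^2\big)\,\mathcal L_{\mathcal I_m}\!\big(q\,s_{\rm LS}(\theta)\big)\,f_{\theta_{m,0}}(\theta)\,d\theta.$$ **Claim (coverage probability under the approximation $F\approx A$ of the fading distribution).** 1. If $F(x)=A(x)$ for all $x\ge0$, then $\mathcal P_{m,\rm cov}=Q$. 2. If $|F(x)-A(x)|\le\varepsilon$ for all $x\ge0$, then $|\mathcal P_{m,\rm cov}-Q|\le\varepsilon\,\mathcal P_{m,\rm av}$. 3. If $F\le A$ on $[0,\infty)$, then $\mathcal P_{m,\rm cov}\ge Q$; if $F\ge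 A$ on $[0,\infty)$, then $\mathcal P_{m,\rm cov}\le Q$. 4. If $m_1=1$ and the fading of the typical device is also Gamma with shape $m_1$ and scale $m_2$, then $\mathcal P_{m,\rm cov}=Q$. -/

import Mathlib

open MeasureTheory ProbabilityTheory

namespace LEOUplink

noncomputable section

/-- Physical space, with the centre of the Earth at the origin. -/
abbrev Space : Type := EuclideanSpace ℝ (Fin 3)

/-- The surface area measure of the sphere of radius `R` about the origin, as a measure on space
(the surface measure of the unit sphere, pushed forward by the dilation and scaled by `R ^ 2`). -/
def sphereArea (R : ℝ) : Measure Space :=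
  ENNReal.ofReal (R ^ 2) •
    ((volume : Measure Space).toSphere).map
      (fun n : Metric.sphere (0 : Space) 1 => R • (n : Space))

/-- The uniform probability distribution on the sphere of radius `R` about the origin. -/
def sphereUniform (R : ℝ) : Measure Space :=
  (sphereArea R Set.univ)⁻¹ • sphereArea R

/-- The number of points among `p 1 ω, …, p (n ω) ω` that lie in `B`. -/
def pointCount {Ω E : Type*} (n : Ω → ℕ) (p : ℕ → Ω → E) (B : Set E) (ω : Ω) : ℕ :=
  {i : ℕ | i ∈ Finset.Icc 1 (n ω) ∧ p i ω ∈ B}.ncard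

/-- The random finite configuration `p 1, …, p n` is a Poisson point process with (finite)
intensity measure `Λ`: the number of points in a measurable set `B` is Poisson distributed
with mean `Λ B`, and the numbers of points in pairwise disjoint measurable sets are
independent. -/
structure IsPoissonProcess {Ω E : Type*} [MeasurableSpace Ω] [MeasurableSpace E]
    (Λ : Measure E) (n : Ω → ℕ) (p : ℕ → Ω → E) (μ : Measure Ω) : Prop where
  measurable_num : Measurable n
  measurable_point : ∀ i, Measurable (p i)
  law_count : ∀ B : Set E, MeasurableSet B →
    HasLaw (pointCount n p B) (poissonMeasure (Λ B).toNNReal) μ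
  indep_count : ∀ (k : ℕ) (B : Fin k → Set E), (∀ j, MeasurableSet (B j)) →
    Pairwise (fun i j => Disjoint (B i) (B j)) →
    iIndepFun (fun j => pointCount n p (B j)) μ

/-- The deterministic parameters of a `K`-tier network. -/
structure Network (K : ℕ) where
  /-- radius of the Earth -/
  earthRadius : ℝ
  /-- altitude of each tier -/
  altitude : Fin K → ℝ
  /-- number of satellites of each tier -/
  numSat : Fin K → ℕ
  /-- half beamwidth angle of the satellites -/
  beam : ℝ
  /-- density of the devices per unit of area of the Earth's surface -/
  density : ℝ
  /-- speed of light -/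
  c : ℝ
  /-- carrier frequency -/
  freq : ℝ
  /-- transmit power of a device -/
  power : ℝ
  /-- product of the gains of the transmitting and receiving antennas -/
  gain : ℝ
  /-- noise spectral density -/
  noiseDensity : ℝ
  /-- bandwidth -/
  bandwidth : ℝ
  /-- information-bearing ratio: the share of the power that carries the message -/
  γ : ℝ
  /-- SINR threshold of the legitimate link -/
  β : ℝ
  /-- shape parameter of the Gamma fading -/
  m₁ : ℕ
  /-- scale parameter of the Gamma fading -/
  m₂ : ℝ
  earthRadius_pos : 0 < earthRadius
  altitude_pos : ∀ k, 0 < altitude k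
  numSat_pos : ∀ k, 0 < numSat k
  beam_pos : 0 < beam
  density_pos : 0 < density
  c_pos : 0 < c
  freq_pos : 0 < freq
  power_pos : 0 < power
  gain_pos : 0 < gain
  noiseDensity_pos : 0 < noiseDensity
  bandwidth_pos : 0 < bandwidth
  γ_pos : 0 < γ
  γ_le_one : γ ≤ 1
  β_pos : 0 < β
  m₁_pos : 0 < m₁
  m₂_pos : 0 < m₂

namespace Network

variable {K : ℕ} (net : Network K) (m : Fin K)

/-- The radius of the orbital sphere of tier `m`. -/
def orbitRadius : ℝ := net.altitude m + net.earthRadius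

/-- The noise power at a satellite. -/
def noise : ℝ := net.noiseDensity * net.bandwidth

/-- The position of the typical device. -/
def typicalDevice : Space := !₂[0, 0, net.earthRadius]

open Classical in
/-- The largest central angle at which a device and a satellite of tier `m` can be linked. -/
def thetaMax : ℝ :=
  if net.beam < Real.arcsin (net.earthRadius / net.orbitRadius m) then
    Real.arcsin (net.orbitRadius m / net.earthRadius * Real.sin net.beam) - net.beam
  else
    Real.arccos (net.earthRadius / net.orbitRadius m)

/-- The distance between a device and a satellite of tier `m` at central angle `θ`. -/
def linkDistance (θ : ℝ) : ℝ :=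
  Real.sqrt (net.earthRadius ^ 2 + net.orbitRadius m ^ 2
    - 2 * net.earthRadius * net.orbitRadius m * Real.cos θ)

/-- The probability density of the contact angle in tier `m`. -/
def contactPDF (θ : ℝ) : ℝ :=
  net.numSat m * Real.sin θ / 2 * ((1 + Real.cos θ) / 2) ^ (net.numSat m - 1)

/-- The availability probability of tier `m`. -/
def availability : ℝ := 1 - ((1 + Real.cos (net.thetaMax m)) / 2) ^ net.numSat m

/-- The Laplace transform of the interference at a satellite of tier `m`. -/
def interferenceLT (s : ℝ) : ℝ :=
  Real.exp (-(net.density *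
    ∫ _φ in (0 : ℝ)..(2 * Real.pi), ∫ θ in (0 : ℝ)..(net.thetaMax m),
      (1 - (1 + net.m₂ * s * net.power * net.gain *
          (net.c / (4 * Real.pi * net.freq * net.linkDistance m θ)) ^ 2) ^ (-(net.m₁ : ℤ)))
        * (net.earthRadius ^ 2 * Real.sin θ)))

/-- The constant `(m₁!) ^ (-1 / m₁) / m₂` of the exponential approximation of the Gamma law. -/
def fadingRate : ℝ := (net.m₁.factorial : ℝ) ^ (-(1 : ℝ) / (net.m₁ : ℝ)) / net.m₂

/-- The approximation, on the half-line `0 ≤ x`, of the distribution function of the fading by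
that of the Gamma law. -/
def approxCDF (x : ℝ) : ℝ := (1 - Real.exp (-(net.fadingRate * x))) ^ net.m₁

/-- The quantity `s_LS`, as a function of the contact angle. -/
def sLS (θ : ℝ) : ℝ :=
  net.fadingRate * (net.β / (net.γ * net.power * net.gain)) *
    (4 * Real.pi * net.freq * net.linkDistance m θ / net.c) ^ 2

/-- The closed form of the coverage probability. -/
def coverageFormula : ℝ :=
  ∑ q ∈ Finset.Icc 1 net.m₁, (net.m₁.choose q : ℝ) * (-1) ^ (q + 1) *
    ∫ θ in (0 : ℝ)..(net.thetaMax m),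
      Real.exp (-(q * net.sLS m θ * net.noise)) *
        net.interferenceLT m (q * net.sLS m θ) * net.contactPDF m θ

open Classical in
/-- The power that a satellite of tier `m` at `x` receives from a device at `u` when the power of
the small-scale fading is `g`. No power is received across a link that leaves the main lobe or
the line of sight. -/
def receivedPower (u x : Space) (g : ℝ) : ℝ :=
  if InnerProductGeometry.angle u x < net.thetaMax m then
    net.power * (net.c / (4 * Real.pi * net.freq * dist u x)) ^ 2 * net.gain * g
  else 0

end Network

/-- The random uplink of the typical device (device `0`) to its nearest satellite in tier `m`.
`ν` is the law of the fading power on the link of the typical device. -/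
structure Uplink {K : ℕ} (net : Network K) (m : Fin K) (ν : Measure ℝ)
    {Ω : Type*} [MeasurableSpace Ω] (μ : Measure Ω) where
  /-- positions of the satellites of tier `m` -/
  sat : Fin (net.numSat m) → Ω → Space
  /-- number of the other devices -/
  numDev : Ω → ℕ
  /-- positions of the devices; the other devices are those with index `1, …, numDev` -/
  dev : ℕ → Ω → Space
  /-- power of the small-scale fading between each device and the serving satellite -/
  fading : ℕ → Ω → ℝ
  /-- index of the serving satellite -/
  serving : Ω → Fin (net.numSat m)
  /-- the satellites form a binomial point process -/
  sat_law : ∀ j, HasLaw (sat j) (sphereUniform (net.orbitRadius m)) μ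
  sat_measurable : ∀ j, Measurable (sat j)
  sat_indep : iIndepFun sat μ
  dev_zero : ∀ ω, dev 0 ω = net.typicalDevice
  /-- the other devices form a homogeneous Poisson point process on the surface of the Earth -/
  dev_poisson : IsPoissonProcess
    (ENNReal.ofReal net.density • sphereArea net.earthRadius) numDev dev μ
  fading_measurable : ∀ i, Measurable (fading i)
  fading_zero_law : HasLaw (fading 0) ν μ
  /-- the fading of the interfering devices is Gamma with shape `m₁` and scale `m₂` -/
  fading_law : ∀ i, i ≠ 0 → HasLaw (fading i) (gammaMeasure (net.m₁ : ℝ) (1 / net.m₂)) μ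
  fading_indep : iIndepFun fading μ
  /-- satellites, devices and fading are mutually independent -/
  indep_sat_dev : IndepFun (fun ω j => sat j ω) (fun ω => (numDev ω, fun i => dev i ω)) μ
  indep_fading : IndepFun (fun ω i => fading i ω)
    (fun ω => ((fun j => sat j ω), (numDev ω, fun i => dev i ω))) μ
  /-- the typical device is served by its nearest satellite -/
  serving_nearest : ∀ ω j,
    dist net.typicalDevice (sat (serving ω) ω) ≤ dist net.typicalDevice (sat j ω)

namespace Uplink

variable {K : ℕ} {net : Network K} {m : Fin K} {ν : Measure ℝ}
  {Ω : Type*} [MeasurableSpace Ω] {μ : Measure Ω} (S : Uplink net m ν μ)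

/-- The power that the serving satellite receives from device `i`. -/
def power (i : ℕ) (ω : Ω) : ℝ :=
  net.receivedPower m (S.dev i ω) (S.sat (S.serving ω) ω) (S.fading i ω)

/-- The interference at the serving satellite. -/
def interference (ω : Ω) : ℝ := ∑ i ∈ Finset.Icc 1 (S.numDev ω), S.power i ω

/-- The SINR at the serving satellite. -/
def sinr (ω : Ω) : ℝ := net.γ * S.power 0 ω / (S.interference ω + net.noise)

/-- The coverage probability. -/
def coverage : ℝ := μ.real {ω | net.β < S.sinr ω}

end Uplink

end

end LEOUplink

/-!
Given the satellites and the interfering devices, the typical device is covered exactly when the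
serving satellite is linked to it and its fading power exceeds a threshold, proportional to
interference plus noise. So if `τ` denotes the law of the threshold on the event of a link, a
measure whose mass is the availability, then independence of the fading gives
`coverage = ∫ (1 - F) dτ`.

By the binomial theorem `1 - A` is a combination of exponentials, and the exponential moments of `τ`
are those in the closed form: the contact angle has the density of the least of `N_m` independent
angles, and the interference at a given satellite has the Laplace transform provided by the
probability generating functional of a Poisson process and the Laplace transform of the Gamma law.
Hence `coverageFormula = ∫ (1 - A) dτ`, and every claim follows by comparing `F` with `A` under the
integral with respect to `τ`.
-/

namespace LEOUplink

noncomputable section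

section Independence

variable {Ω α β γ : Type*} [MeasurableSpace Ω] [MeasurableSpace α] [MeasurableSpace β]
  [MeasurableSpace γ] {μ : Measure Ω}

theorem indepFun_update_of_iIndepFun {ι : Type*} [DecidableEq ι] {X : ι → Ω → α}
    (hX : ∀ i, Measurable (X i)) (hind : iIndepFun X μ) (i : ι) (c : α) :
    IndepFun (X i) (fun ω => Function.update (fun k => X k ω) i c) μ := by
  have h := indep_iSup_of_disjoint (fun k => (hX k).comap_le) hind
    (disjoint_compl_right : Disjoint {i} {i}ᶜ)
  rw [IndepFun_iff_Indep]
  refine indep_of_indep_of_le_left (indep_of_indep_of_le_right h ?_)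
    (le_iSup₂_of_le i rfl le_rfl)
  refine measurable_iff_comap_le.1 (@measurable_pi_lambda _ _ _ (_) _ _ fun k => ?_)
  by_cases hk : k = i
  · subst hk
    simpa only [Function.update_self] using measurable_const
  · simp only [Function.update_of_ne hk]
    exact measurable_iff_comap_le.2 (le_iSup₂_of_le k hk le_rfl)

variable [IsFiniteMeasure μ]

theorem lintegral_comp_of_indepFun {X : Ω → α} {Y : Ω → β} {P : Measure β}
    (hX : AEMeasurable X μ) (hY : HasLaw Y P μ) (h : IndepFun X Y μ) {f : α → β → ENNReal}
    (hf : Measurable (Function.uncurry f)) :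
    ∫⁻ ω, f (X ω) (Y ω) ∂μ = ∫⁻ ω, ∫⁻ y, f (X ω) y ∂P ∂μ := by
  have hX' : HasLaw X (μ.map X) μ := ⟨hX, rfl⟩
  have hXY := (indepFun_iff_hasLaw_prodMk_prod hX' hY).1 h
  have : IsFiniteMeasure P := hY.map_eq ▸ inferInstance
  calc ∫⁻ ω, f (X ω) (Y ω) ∂μ = ∫⁻ q, Function.uncurry f q ∂((μ.map X).prod P) :=
        hXY.lintegral_comp hf.aemeasurable
    _ = ∫⁻ x, ∫⁻ y, f x y ∂P ∂(μ.map X) := lintegral_prod _ hf.aemeasurable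
    _ = ∫⁻ ω, ∫⁻ y, f (X ω) y ∂P ∂μ :=
        lintegral_map' (Measurable.lintegral_prod_right hf).aemeasurable hX

theorem setLIntegral_preimage_of_indepFun {X : Ω → α} {Y : Ω → β} {P : Measure β}
    (hX : Measurable X) (hY : HasLaw Y P μ) (h : IndepFun X Y μ) {A : Set α}
    (hA : MeasurableSet A) {f : α → β → ENNReal} (hf : Measurable (Function.uncurry f)) :
    ∫⁻ ω in X ⁻¹' A, f (X ω) (Y ω) ∂μ = ∫⁻ ω in X ⁻¹' A, ∫⁻ y, f (X ω) y ∂P ∂μ := by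
  have hfA : Measurable (Function.uncurry fun x y => A.indicator (f · y) x) :=
    hf.indicator (measurable_fst hA)
  rw [← lintegral_indicator (hX hA), ← lintegral_indicator (hX hA)]
  refine (lintegral_comp_of_indepFun hX.aemeasurable hY h hfA).trans (lintegral_congr fun ω => ?_)
  by_cases hω : X ω ∈ A <;> simp [hω]

theorem measure_preimage_inter_lt_of_indepFun {X : Ω → α} {Y : Ω → ℝ} {P : Measure ℝ}
    (hX : Measurable X) (hY : HasLaw Y P μ) (hYm : Measurable Y) (h : IndepFun X Y μ)
    {A : Set α} (hA : MeasurableSet A) {t : α → ℝ} (ht : Measurable t) :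
    μ (X ⁻¹' A ∩ {ω | t (X ω) < Y ω}) = ∫⁻ ω in X ⁻¹' A, P (Set.Ioi (t (X ω))) ∂μ := by
  have hlt : MeasurableSet {ω | t (X ω) < Y ω} := measurableSet_lt (ht.comp hX) hYm
  have hf : Measurable (Function.uncurry fun x => (Set.Ioi (t x)).indicator (1 : ℝ → ENNReal)) :=
    measurable_one.indicator (s := {q : α × ℝ | t q.1 < q.2})
      (measurableSet_lt (ht.comp measurable_fst) measurable_snd)
  rw [Set.inter_comm, ← Measure.restrict_apply hlt, ← lintegral_indicator_one hlt]
  refine (setLIntegral_preimage_of_indepFun hX hY h hA hf).trans (lintegral_congr fun ω => ?_)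
  exact lintegral_indicator_one measurableSet_Ioi

theorem setLIntegral_comp_of_indepFun {X : Ω → α} {Y : Ω → β} {P : Measure β}
    (hX : AEMeasurable X μ) (hY : HasLaw Y P μ) (h : IndepFun X Y μ) {φ : α → ENNReal}
    (hφ : Measurable φ) {T : Set (α × β)} (hT : MeasurableSet T) :
    ∫⁻ ω in {ω | (X ω, Y ω) ∈ T}, φ (X ω) ∂μ
      = ∫⁻ ω, φ (X ω) * P (Prod.mk (X ω) ⁻¹' T) ∂μ := by
  have hXY : NullMeasurableSet {ω | (X ω, Y ω) ∈ T} μ :=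
    (hX.prodMk hY.aemeasurable).nullMeasurable hT
  rw [← lintegral_indicator₀ hXY]
  refine (lintegral_comp_of_indepFun (f := fun x y => T.indicator (fun q => φ q.1) (x, y)) hX hY h
    ((hφ.comp measurable_fst).indicator hT)).trans (lintegral_congr fun ω => ?_)
  exact lintegral_indicator_const (measurable_prodMk_left hT) (φ (X ω))

theorem indepFun_prodMk_assoc {X : Ω → α} {Y : Ω → β} {Z : Ω → γ}
    (hX : Measurable X) (hY : Measurable Y) (hZ : Measurable Z) (hXY : IndepFun X Y μ)
    (h : IndepFun (fun ω => (X ω, Y ω)) Z μ) : IndepFun X (fun ω => (Y ω, Z ω)) μ := by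
  have hYZ : IndepFun Y Z μ := h.comp measurable_snd measurable_id
  rw [indepFun_iff_map_prod_eq_prod_map_map (by fun_prop) (by fun_prop)] at *
  rw [hYZ, ← MeasurePreserving.map_eq (measurePreserving_prodAssoc _ _ _), ← hXY, ← h,
    Measure.map_map (by fun_prop) (by fun_prop)]
  rfl

theorem setLIntegral_forall_lt_of_iIndepFun {ι : Type*} [Fintype ι] {X : ι → Ω → ℝ}
    {P : Measure ℝ} (hX : ∀ i, HasLaw (X i) P μ) (hind : iIndepFun X μ) (j : ι)
    {φ : ℝ → ENNReal} (hφ : Measurable φ) :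
    ∫⁻ ω in {ω | ∀ i, i ≠ j → X j ω < X i ω}, φ (X j ω) ∂μ
      = ∫⁻ t, φ t * P (Set.Ioi t) ^ (Fintype.card ι - 1) ∂P := by
  classical
  have := hind.isProbabilityMeasure
  have : IsFiniteMeasure P := (hX j).map_eq ▸ inferInstance
  let others : Finset ι := {j}ᶜ
  let T : Set (ℝ × (others → ℝ)) := {q | ∀ i, q.1 < q.2 i}
  have hT : MeasurableSet T := by
    simp only [T, Set.ofPred_forall]
    exact MeasurableSet.iInter fun i => measurableSet_lt (by fun_prop) (by fun_prop)
  have hlaw : HasLaw (fun ω (i : others) => X i ω) (Measure.pi fun _ => P) μ :=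
    (hind.precomp Subtype.val_injective).hasLaw_pi fun i => hX i
  have hindep : IndepFun (X j) (fun ω (i : others) => X i ω) μ :=
    (hind.indepFun_finset₀ {j} others disjoint_compl_right fun i => (hX i).aemeasurable).comp
      (measurable_pi_apply (⟨j, Finset.mem_singleton_self j⟩ : ({j} : Finset ι))) measurable_id
  have hslice : ∀ t, Measure.pi (fun _ => P) (Prod.mk t ⁻¹' T)
      = P (Set.Ioi t) ^ (Fintype.card ι - 1) := fun t => by
    have : Prod.mk t ⁻¹' T = Set.univ.pi fun _ => Set.Ioi t := by ext; simp [T]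
    rw [this, Measure.pi_pi, Finset.prod_const, Finset.card_univ]
    simp [others]
  have hset : {ω | ∀ i, i ≠ j → X j ω < X i ω} = {ω | (X j ω, fun i : others => X i ω) ∈ T} := by
    ext ω; simp [T, others]
  have htail : Measurable fun t => P (Set.Ioi t) := Antitone.measurable fun s t hst =>
    measure_mono (Set.Ioi_subset_Ioi hst)
  rw [hset, setLIntegral_comp_of_indepFun (hX j).aemeasurable hlaw hindep hφ hT]
  simp_rw [hslice]
  exact (hX j).lintegral_comp (f := fun t => φ t * P (Set.Ioi t) ^ (Fintype.card ι - 1))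
    (hφ.mul (htail.pow_const _)).aemeasurable

end Independence

section Laws

theorem lintegral_exp_neg_mul_gammaMeasure {a r b : ℝ} (ha : 0 < a) (hr : 0 < r) (hb : -r < b) :
    ∫⁻ x, ENNReal.ofReal (Real.exp (-(b * x))) ∂(gammaMeasure a r)
      = ENNReal.ofReal ((1 + b / r) ^ (-a)) := by
  have hrb : 0 < r + b := by linarith
  have hdiv : 1 + b / r = (r + b) / r := by field_simp
  have tilt : ∀ x, gammaPDF a r x * ENNReal.ofReal (Real.exp (-(b * x)))
      = ENNReal.ofReal ((1 + b / r) ^ (-a)) * gammaPDF a (r + b) x := by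
    intro x
    rw [gammaPDF, gammaPDF, ← ENNReal.ofReal_mul (gammaPDFReal_nonneg ha hr x),
      ← ENNReal.ofReal_mul (by rw [hdiv]; positivity), gammaPDFReal, gammaPDFReal]
    congr 1
    split_ifs with hx
    · rw [hdiv, Real.rpow_neg (by positivity), Real.div_rpow hrb.le hr.le,
        show -((r + b) * x) = -(r * x) + -(b * x) by ring, Real.exp_add]
      field_simp
    · simp
  rw [gammaMeasure, lintegral_withDensity_eq_lintegral_mul _
    (by unfold gammaPDF; fun_prop) (by fun_prop)]
  simp only [Pi.mul_apply, tilt]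
  rw [lintegral_const_mul _ (by unfold gammaPDF; fun_prop), lintegral_gammaPDF_eq_one ha hrb,
    mul_one]

theorem ae_nonneg_gammaMeasure (a r : ℝ) : ∀ᵐ x ∂(gammaMeasure a r), 0 ≤ x := by
  rw [gammaMeasure, ae_withDensity_iff (by unfold gammaPDF; fun_prop)]
  refine ae_of_all _ fun x hx => ?_
  by_contra h
  exact hx (gammaPDF_of_neg (not_le.1 h))

theorem integral_pow_poissonMeasure (r : NNReal) (a : ℝ) :
    ∫ n, a ^ n ∂(poissonMeasure r) = Real.exp (-(r * (1 - a))) := by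
  have hexp := (NormedSpace.expSeries_div_hasSum_exp (𝔸 := ℝ) ((r : ℝ) * a)).tsum_eq
  rw [← Real.exp_eq_exp_ℝ] at hexp
  calc ∫ n, a ^ n ∂(poissonMeasure r)
      = ∑' n : ℕ, Real.exp (-r) * ((r * a) ^ n / (n.factorial : ℝ)) := by
        rw [integral_poissonMeasure]
        exact tsum_congr fun n => by rw [smul_eq_mul, mul_pow]; ring
    _ = Real.exp (-(r * (1 - a))) := by
        rw [tsum_mul_left, hexp, ← Real.exp_add]
        ring_nf

end Laws

theorem measurable_comp_nat {α β : Type*} [MeasurableSpace α] [MeasurableSpace β]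
    {F : ℕ → α → β} (hF : ∀ n, Measurable (F n)) {N : α → ℕ} (hN : Measurable N) :
    Measurable fun a => F (N a) a :=
  (measurable_from_prod_countable_right (f := fun p : ℕ × α => F p.1 p.2) hF).comp
    (hN.prodMk measurable_id)

theorem prod_Icc_comp_eq_prod_pow_pointCount {Ω E ι R : Type*} [Fintype ι] [CommMonoid R]
    (n : Ω → ℕ) (p : ℕ → Ω → E) (idx : E → ι) (a : ι → R) (ω : Ω) :
    ∏ i ∈ Finset.Icc 1 (n ω), a (idx (p i ω))
      = ∏ j, a j ^ pointCount n p (idx ⁻¹' {j}) ω := by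
  classical
  rw [← Finset.prod_fiberwise (Finset.Icc 1 (n ω)) (fun i => idx (p i ω))]
  refine Finset.prod_congr rfl fun j _ => ?_
  rw [Finset.prod_congr rfl (g := fun _ => a j)
    (fun i hi => by rw [(Finset.mem_filter.1 hi).2]), Finset.prod_const, pointCount,
    ← Set.ncard_coe_finset]
  congr 2
  ext i
  simp

namespace IsPoissonProcess

variable {Ω E : Type*} [MeasurableSpace Ω] [MeasurableSpace E] {Λ : Measure E} {n : Ω → ℕ}
  {p : ℕ → Ω → E} {μ : Measure Ω}

theorem iIndepFun_pointCount (h : IsPoissonProcess Λ n p μ) {ι : Type*} [Finite ι]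
    {B : ι → Set E} (hB : ∀ j, MeasurableSet (B j))
    (hd : Pairwise (Function.onFun Disjoint B)) :
    iIndepFun (fun j => pointCount n p (B j)) μ := by
  let e := Finite.equivFin ι
  have := (h.indep_count _ (fun k => B (e.symm k)) (fun _ => hB _)
    fun i j hij => hd (e.symm.injective.ne hij)).precomp e.injective
  simpa only [Equiv.symm_apply_apply] using this

theorem integral_pow_pointCount (h : IsPoissonProcess Λ n p μ) {B : Set E}
    (hB : MeasurableSet B) (a : ℝ) :
    ∫ ω, a ^ pointCount n p B ω ∂μ = Real.exp (-(Λ.real B * (1 - a))) :=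
  ((h.law_count B hB).integral_comp (f := fun N : ℕ => a ^ N) .of_discrete).trans
    (integral_pow_poissonMeasure _ a)

variable [IsFiniteMeasure Λ]

theorem integral_prod_simpleFunc (h : IsPoissonProcess Λ n p μ) (f : SimpleFunc E ℝ) :
    ∫ ω, ∏ i ∈ Finset.Icc 1 (n ω), f (p i ω) ∂μ = Real.exp (-∫ u, (1 - f u) ∂Λ) := by
  let idx : E → f.range := fun u => ⟨f u, f.mem_range_self u⟩
  have hidx : Measurable idx := f.measurable.subtype_mk
  have hB : ∀ j, MeasurableSet (idx ⁻¹' {j}) := fun j => hidx (measurableSet_singleton j)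
  have hd : Pairwise (Function.onFun Disjoint fun j => idx ⁻¹' {j}) := fun i j hij =>
    Disjoint.preimage _ (by simpa using hij)
  have hint : ∫ u, (1 - f u) ∂Λ = ∑ j, Λ.real (idx ⁻¹' {j}) * (1 - (j : ℝ)) := by
    rw [← integral_map (f := fun j : f.range => 1 - (j : ℝ)) hidx.aemeasurable .of_discrete,
      integral_fintype .of_finite]
    exact Finset.sum_congr rfl fun j _ => by
      rw [smul_eq_mul, map_measureReal_apply hidx (measurableSet_singleton j)]
  calc ∫ ω, ∏ i ∈ Finset.Icc 1 (n ω), f (p i ω) ∂μ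
      = ∫ ω, ∏ j : f.range, (j : ℝ) ^ pointCount n p (idx ⁻¹' {j}) ω ∂μ :=
        integral_congr_ae <| ae_of_all _ fun ω =>
          prod_Icc_comp_eq_prod_pow_pointCount n p idx (fun j => (j : ℝ)) ω
    _ = ∏ j : f.range, ∫ ω, (j : ℝ) ^ pointCount n p (idx ⁻¹' {j}) ω ∂μ :=
        (h.iIndepFun_pointCount hB hd).integral_fun_prod_comp
          (f := fun (j : f.range) N => (j : ℝ) ^ N)
          (fun j => (h.law_count _ (hB j)).aemeasurable) fun j => .of_discrete
    _ = Real.exp (-∫ u, (1 - f u) ∂Λ) := by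
        simp_rw [h.integral_pow_pointCount (hB _)]
        rw [← Real.exp_sum, Finset.sum_neg_distrib, hint]

variable [IsProbabilityMeasure μ]

theorem integral_prod (h : IsPoissonProcess Λ n p μ) {v : E → ℝ} (hv : Measurable v)
    (hv01 : ∀ u, v u ∈ Set.Icc 0 1) :
    ∫ ω, ∏ i ∈ Finset.Icc 1 (n ω), v (p i ω) ∂μ = Real.exp (-∫ u, (1 - v u) ∂Λ) := by
  let w : ℕ → SimpleFunc E ℝ := SimpleFunc.approxOn v hv (Set.Icc 0 1) 0 (by simp)
  have hw : ∀ k u, w k u ∈ Set.Icc 0 1 := SimpleFunc.approxOn_mem hv _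
  have hlim : ∀ u, Filter.Tendsto (fun k => w k u) Filter.atTop (nhds (v u)) := fun u =>
    SimpleFunc.tendsto_approxOn hv _ (subset_closure (hv01 u))
  have hprod : Filter.Tendsto (fun k => ∫ ω, ∏ i ∈ Finset.Icc 1 (n ω), w k (p i ω) ∂μ)
      Filter.atTop (nhds (∫ ω, ∏ i ∈ Finset.Icc 1 (n ω), v (p i ω) ∂μ)) := by
    refine tendsto_integral_of_dominated_convergence (fun _ => 1) (fun k => ?_)
      (integrable_const _) (fun k => ae_of_all _ fun ω => ?_)
      (ae_of_all _ fun ω => tendsto_finsetProd _ fun i _ => hlim _)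
    · exact (measurable_comp_nat (F := fun N ω => ∏ i ∈ Finset.Icc 1 N, w k (p i ω))
        (fun N => Finset.measurable_fun_prod _ fun i _ =>
          (w k).measurable.comp (h.measurable_point i)) h.measurable_num).aestronglyMeasurable
    · rw [Real.norm_of_nonneg (Finset.prod_nonneg fun i _ => (hw k _).1)]
      exact Finset.prod_le_one (fun i _ => (hw k _).1) fun i _ => (hw k _).2
  have hexp : Filter.Tendsto (fun k => ∫ u, (1 - w k u) ∂Λ) Filter.atTop
      (nhds (∫ u, (1 - v u) ∂Λ)) := by
    refine tendsto_integral_of_dominated_convergence (fun _ => 1)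
      (fun k => (measurable_const.sub (w k).measurable).aestronglyMeasurable)
      (integrable_const _) (fun k => ae_of_all _ fun u => ?_)
      (ae_of_all _ fun u => (hlim u).const_sub 1)
    rw [Real.norm_of_nonneg (sub_nonneg.2 (hw k u).2)]
    exact sub_le_self _ (hw k u).1
  simp_rw [h.integral_prod_simpleFunc] at hprod
  exact tendsto_nhds_unique hprod ((Real.continuous_exp.tendsto _).comp hexp.neg)

theorem lintegral_prod (h : IsPoissonProcess Λ n p μ) {v : E → ENNReal} (hv : Measurable v)
    (hv1 : ∀ u, v u ≤ 1) :
    ∫⁻ ω, ∏ i ∈ Finset.Icc 1 (n ω), v (p i ω) ∂μ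
      = ENNReal.ofReal (Real.exp (-∫ u, (1 - (v u).toReal) ∂Λ)) := by
  have hprod1 : ∀ ω, ∏ i ∈ Finset.Icc 1 (n ω), v (p i ω) ≤ 1 := fun ω =>
    Finset.prod_le_one' fun i _ => hv1 _
  have hm : Measurable fun ω => ∏ i ∈ Finset.Icc 1 (n ω), v (p i ω) :=
    measurable_comp_nat (F := fun N ω => ∏ i ∈ Finset.Icc 1 N, v (p i ω))
      (fun N => Finset.measurable_fun_prod _ fun i _ => hv.comp (h.measurable_point i))
      h.measurable_num
  have hfin : ∫⁻ ω, ∏ i ∈ Finset.Icc 1 (n ω), v (p i ω) ∂μ ≠ ⊤ :=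
    ((lintegral_mono hprod1).trans_lt (by simp)).ne
  rw [← h.integral_prod hv.ennreal_toReal fun u =>
      ⟨ENNReal.toReal_nonneg, ENNReal.toReal_mono ENNReal.one_ne_top (hv1 u)⟩]
  simp_rw [← ENNReal.toReal_prod]
  rw [integral_toReal hm.aemeasurable
    (ae_of_all _ fun ω => (hprod1 ω).trans_lt ENNReal.one_lt_top), ENNReal.ofReal_toReal hfin]

theorem lintegral_prod_marks {M : Type*} [MeasurableSpace M] {ρ : Measure M} [SFinite ρ]
    (hp : IsPoissonProcess Λ n p μ) {h : ℕ → Ω → M} (hm : ∀ i, Measurable (h i))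
    (hlaw : ∀ i, i ≠ 0 → HasLaw (h i) ρ μ) (hind : iIndepFun h μ)
    (hph : IndepFun (fun ω => (n ω, fun i => p i ω)) (fun ω i => h i ω) μ)
    {φ : E → M → ENNReal} (hφ : Measurable (Function.uncurry φ))
    (hφ1 : ∀ u, ∫⁻ y, φ u y ∂ρ ≤ 1) :
    ∫⁻ ω, ∏ i ∈ Finset.Icc 1 (n ω), φ (p i ω) (h i ω) ∂μ
      = ENNReal.ofReal (Real.exp (-∫ u, (1 - (∫⁻ y, φ u y ∂ρ).toReal) ∂Λ)) := by
  let G : ℕ × (ℕ → E) → (ℕ → M) → ENNReal := fun d y => ∏ i ∈ Finset.Icc 1 d.1, φ (d.2 i) (y i)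
  have hG : Measurable (Function.uncurry G) :=
    measurable_comp_nat
      (F := fun N (q : (ℕ × (ℕ → E)) × (ℕ → M)) => ∏ i ∈ Finset.Icc 1 N, φ (q.1.2 i) (q.2 i))
      (fun N => Finset.measurable_fun_prod _ fun i _ => hφ.comp
        (f := fun q : (ℕ × (ℕ → E)) × (ℕ → M) => (q.1.2 i, q.2 i)) (by fun_prop)) (by fun_prop)
  have hD : Measurable fun ω => (n ω, fun i => p i ω) :=
    hp.measurable_num.prodMk (measurable_pi_lambda _ hp.measurable_point)
  have hH : Measurable fun ω i => h i ω := measurable_pi_lambda _ hm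
  have hmark : ∀ d : ℕ × (ℕ → E), ∫⁻ ω, G d (fun i => h i ω) ∂μ
      = ∏ i ∈ Finset.Icc 1 d.1, ∫⁻ y, φ (d.2 i) y ∂ρ := by
    intro d
    have hφd : ∀ i, Measurable (φ (d.2 i)) := fun i => hφ.comp measurable_prodMk_left
    refine (lintegral_prod_eq_prod_lintegral_of_indepFun _ _
      (hind.comp (fun i => φ (d.2 i)) hφd) fun i => (hφd i).comp (hm i)).trans ?_
    exact Finset.prod_congr rfl fun i hi => (hlaw i (by grind)).lintegral_comp (hφd i).aemeasurable
  calc ∫⁻ ω, G (n ω, fun i => p i ω) (fun i => h i ω) ∂μ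
      = ∫⁻ ω, ∫⁻ y, G (n ω, fun i => p i ω) y ∂(μ.map fun ω i => h i ω) ∂μ :=
        lintegral_comp_of_indepFun hD.aemeasurable ⟨hH.aemeasurable, rfl⟩ hph hG
    _ = ∫⁻ ω, ∏ i ∈ Finset.Icc 1 (n ω), ∫⁻ y, φ (p i ω) y ∂ρ ∂μ :=
        lintegral_congr fun ω => (lintegral_map hG.of_uncurry_left hH).trans (hmark _)
    _ = _ := hp.lintegral_prod (Measurable.lintegral_prod_right hφ) hφ1

end IsPoissonProcess

section Sphere

open InnerProductGeometry Set Real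
open scoped Pointwise

theorem measurable_angle_left {E : Type*} [NormedAddCommGroup E] [InnerProductSpace ℝ E]
    [MeasurableSpace E] [OpensMeasurableSpace E] (x : E) : Measurable fun y => angle y x :=
  measurable_arccos.comp ((Continuous.inner continuous_id continuous_const).measurable.div
    (measurable_norm.mul_const _))

theorem lintegral_polar_plane {F : ℝ → ℝ → ENNReal} (hF : Measurable (Function.uncurry F)) :
    ∫⁻ w : ℝ × ℝ, F w.1 w.2
      = ∫⁻ r in Ioi (0 : ℝ), ∫⁻ φ in Ioo (-π) π,
          ENNReal.ofReal r * F (r * cos φ) (r * sin φ) := by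
  rw [← lintegral_comp_polarCoord_symm, polarCoord_target, Measure.volume_eq_prod,
    setLIntegral_prod]
  · rfl
  · exact ((ENNReal.measurable_ofReal.comp measurable_fst).mul
      (hF.comp continuous_polarCoord_symm.measurable)).aemeasurable

theorem sqrt_sq_mul_cos_add_sq_mul_sin {r : ℝ} (hr : 0 ≤ r) (θ : ℝ) :
    √((r * cos θ) ^ 2 + (r * sin θ) ^ 2) = r := by
  rw [show (r * cos θ) ^ 2 + (r * sin θ) ^ 2 = r ^ 2 by
    linear_combination r ^ 2 * sin_sq_add_cos_sq θ, sqrt_sq hr]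

theorem lintegral_norm_plane {f : ℝ → ENNReal} (hf : Measurable f) :
    ∫⁻ w : ℝ × ℝ, f √(w.1 ^ 2 + w.2 ^ 2)
      = ENNReal.ofReal (2 * π) * ∫⁻ r in Ioi (0 : ℝ), ENNReal.ofReal r * f r := by
  rw [lintegral_polar_plane (F := fun x y => f √(x ^ 2 + y ^ 2)) (by fun_prop),
    ← lintegral_const_mul _ (by fun_prop)]
  refine setLIntegral_congr_fun measurableSet_Ioi fun r (hr : 0 < r) => ?_
  simp only [sqrt_sq_mul_cos_add_sq_mul_sin hr.le, setLIntegral_const, Real.volume_Ioo,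
    mul_comm (ENNReal.ofReal (2 * π))]
  ring_nf

theorem lintegral_polar_upperHalfPlane {F : ℝ → ℝ → ENNReal}
    (hF : Measurable (Function.uncurry F)) :
    ∫⁻ z, ∫⁻ r in Ioi (0 : ℝ), F z r
      = ∫⁻ r in Ioi (0 : ℝ), ∫⁻ θ in Ioo 0 π, ENNReal.ofReal r * F (r * cos θ) (r * sin θ) := by
  have hind : Measurable (Function.uncurry fun z => (Ioi 0).indicator (F z)) :=
    hF.indicator (s := {q : ℝ × ℝ | 0 < q.2}) (measurableSet_lt measurable_const measurable_snd)
  simp_rw [← lintegral_indicator measurableSet_Ioi (F _)]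
  rw [← lintegral_prod (fun q : ℝ × ℝ => (Ioi 0).indicator (F q.1) q.2) hind.aemeasurable,
    ← Measure.volume_eq_prod, lintegral_polar_plane hind]
  refine setLIntegral_congr_fun measurableSet_Ioi fun r (hr : 0 < r) => ?_
  rw [← lintegral_indicator measurableSet_Ioo, ← lintegral_indicator measurableSet_Ioo]
  refine lintegral_congr fun θ => ?_
  by_cases hθ : θ ∈ Ioo 0 π
  · have : 0 < r * sin θ := mul_pos hr (sin_pos_of_mem_Ioo hθ)
    have : θ ∈ Ioo (-π) π := ⟨by linarith [hθ.1, pi_pos], hθ.2⟩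
    simp [*]
  · rw [indicator_of_notMem hθ]
    refine indicator_apply_eq_zero.2 fun hθ' => ?_
    have hsin : sin θ ≤ 0 := sin_nonpos_of_nonpos_of_neg_pi_le
      (not_lt.1 fun h => hθ ⟨h, hθ'.2⟩) hθ'.1.le
    rw [indicator_of_notMem (by simpa using mul_nonpos_of_nonneg_of_nonpos hr.le hsin), mul_zero]

theorem lintegral_cylindrical {F : ℝ → ℝ → ENNReal} (hF : Measurable (Function.uncurry F)) :
    ∫⁻ y : Space, F (y 0) √(y 1 ^ 2 + y 2 ^ 2)
      = ENNReal.ofReal (2 * π) * ∫⁻ z, ∫⁻ r in Ioi (0 : ℝ), ENNReal.ofReal r * F z r := by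
  have hm : ∀ {α : Type} [MeasurableSpace α] {f g : α → ℝ}, Measurable f → Measurable g →
      Measurable fun a => F (f a) (g a) := fun hf hg => hF.comp (hf.prodMk hg)
  calc ∫⁻ y : Space, F (y 0) √(y 1 ^ 2 + y 2 ^ 2)
      = ∫⁻ y : Fin 3 → ℝ, F (y 0) √(y 1 ^ 2 + y 2 ^ 2) :=
        (PiLp.volume_preserving_ofLp (Fin 3)).lintegral_comp
          (f := fun y => F (y 0) √(y 1 ^ 2 + y 2 ^ 2)) (hm (by fun_prop) (by fun_prop))
    _ = ∫⁻ q : ℝ × (Fin 2 → ℝ), F q.1 √(q.2 0 ^ 2 + q.2 1 ^ 2) :=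
        (volume_preserving_piFinSuccAbove (fun _ : Fin 3 => ℝ) 0).lintegral_comp
          (f := fun q => F q.1 √(q.2 0 ^ 2 + q.2 1 ^ 2)) (hm (by fun_prop) (by fun_prop))
    _ = ∫⁻ z, ∫⁻ w : Fin 2 → ℝ, F z √(w 0 ^ 2 + w 1 ^ 2) := by
        rw [Measure.volume_eq_prod,
          lintegral_prod _ (hm (by fun_prop) (by fun_prop)).aemeasurable]
    _ = ∫⁻ z, ∫⁻ w : ℝ × ℝ, F z √(w.1 ^ 2 + w.2 ^ 2) :=
        lintegral_congr fun z => (volume_preserving_finTwoArrow ℝ).lintegral_comp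
          (f := fun w : ℝ × ℝ => F z √(w.1 ^ 2 + w.2 ^ 2)) (hm (by fun_prop) (by fun_prop))
    _ = _ := by
        simp_rw [lintegral_norm_plane hF.of_uncurry_left]
        refine lintegral_const_mul _ (Measurable.lintegral_prod_right'
          (f := fun q : ℝ × ℝ => ENNReal.ofReal q.2 * F q.1 q.2) ?_)
        exact (ENNReal.measurable_ofReal.comp measurable_snd).mul hF

theorem lintegral_spherical_single {G : ℝ → ℝ → ENNReal} (hG : Measurable (Function.uncurry G)) :
    ∫⁻ y : Space, G ‖y‖ (angle y (EuclideanSpace.single 0 1))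
      = ENNReal.ofReal (2 * π) * ∫⁻ r in Ioi (0 : ℝ), ∫⁻ θ in Ioo 0 π,
          ENNReal.ofReal (r ^ 2 * sin θ) * G r θ := by
  let F : ℝ → ℝ → ENNReal := fun z r => G √(z ^ 2 + r ^ 2) (arccos (z / √(z ^ 2 + r ^ 2)))
  have hF : Measurable (Function.uncurry F) := hG.comp
    (f := fun q : ℝ × ℝ => (√(q.1 ^ 2 + q.2 ^ 2), arccos (q.1 / √(q.1 ^ 2 + q.2 ^ 2))))
    (by fun_prop)
  have hcyl : ∀ y : Space, G ‖y‖ (angle y (EuclideanSpace.single 0 1))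
      = F (y 0) √(y 1 ^ 2 + y 2 ^ 2) := fun y => by
    have hnorm : ‖y‖ = √(y 0 ^ 2 + √(y 1 ^ 2 + y 2 ^ 2) ^ 2) := by
      rw [EuclideanSpace.norm_eq, Fin.sum_univ_three, sq_sqrt (by positivity)]
      simp [sq_abs, add_assoc]
    simp [F, ← hnorm, angle, EuclideanSpace.inner_single_right]
  simp_rw [hcyl]
  rw [lintegral_cylindrical hF, lintegral_polar_upperHalfPlane
    (F := fun z r => ENNReal.ofReal r * F z r)
    ((ENNReal.measurable_ofReal.comp measurable_snd).mul hF)]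
  congr 1
  refine setLIntegral_congr_fun measurableSet_Ioi fun r (hr : 0 < r) => ?_
  refine setLIntegral_congr_fun measurableSet_Ioo fun θ hθ => ?_
  simp only [F, sqrt_sq_mul_cos_add_sq_mul_sin hr.le]
  rw [mul_div_cancel_left₀ _ hr.ne', arccos_cos hθ.1.le hθ.2.le, ← mul_assoc,
    ← ENNReal.ofReal_mul hr.le]
  ring_nf

theorem exists_linearIsometryEquiv_apply_eq_single {ι : Type*} [Fintype ι] [DecidableEq ι]
    (i : ι) {x : EuclideanSpace ℝ ι} (hx : ‖x‖ = 1) :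
    ∃ L : EuclideanSpace ℝ ι ≃ₗᵢ[ℝ] EuclideanSpace ℝ ι, L x = EuclideanSpace.single i 1 := by
  have horth : Orthonormal ℝ (({i} : Set ι).domRestrict fun _ => x) := by
    rw [orthonormal_iff_ite]
    rintro ⟨j, rfl⟩ ⟨k, rfl⟩
    simp [Set.domRestrict, hx]
  obtain ⟨b, hb⟩ := horth.exists_orthonormalBasis_extension_of_card_eq (by simp)
  exact ⟨b.repr, by rw [← hb i rfl, b.repr_self]⟩

theorem lintegral_spherical {x : Space} (hx : x ≠ 0) {G : ℝ → ℝ → ENNReal}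
    (hG : Measurable (Function.uncurry G)) :
    ∫⁻ y : Space, G ‖y‖ (angle y x)
      = ENNReal.ofReal (2 * π) * ∫⁻ r in Ioi (0 : ℝ), ∫⁻ θ in Ioo 0 π,
          ENNReal.ofReal (r ^ 2 * sin θ) * G r θ := by
  obtain ⟨L, hL⟩ := exists_linearIsometryEquiv_apply_eq_single 0
    (x := ‖x‖⁻¹ • x) (norm_smul_inv_norm (𝕜 := ℝ) hx)
  have hGm : Measurable fun y : Space => G ‖y‖ (angle y (EuclideanSpace.single 0 1)) := hG.comp
    (f := fun y : Space => (‖y‖, angle y (EuclideanSpace.single 0 1)))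
    (measurable_norm.prodMk (measurable_angle_left _))
  rw [← lintegral_spherical_single hG, ← L.measurePreserving.lintegral_comp hGm]
  refine lintegral_congr fun y => ?_
  rw [L.norm_map, ← hL, show angle (L y) (L (‖x‖⁻¹ • x)) = _ from L.toLinearIsometry.angle_map _ _,
    angle_smul_right_of_pos _ _ (by positivity)]

/-- The measure with density `sin θ` on `(0, π)`: up to a constant factor, the distribution of the
angle between a uniform point of a sphere in `Space` and a fixed direction. -/
def polarAngleMeasure : Measure ℝ :=
  (volume.restrict (Ioo 0 π)).withDensity fun θ => ENNReal.ofReal (sin θ)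

theorem lintegral_polarAngleMeasure {g : ℝ → ENNReal} (hg : Measurable g) :
    ∫⁻ θ, g θ ∂polarAngleMeasure = ∫⁻ θ in Ioo 0 π, ENNReal.ofReal (sin θ) * g θ :=
  lintegral_withDensity_eq_lintegral_mul _ (by fun_prop) hg

theorem ae_mem_Ioo_polarAngleMeasure : ∀ᵐ θ ∂polarAngleMeasure, θ ∈ Ioo 0 π :=
  (withDensity_absolutelyContinuous _ _).ae_le (ae_restrict_mem measurableSet_Ioo)

theorem polarAngleMeasure_Ioi {t : ℝ} (ht : t ∈ Icc 0 π) :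
    polarAngleMeasure (Ioi t) = ENNReal.ofReal (1 + cos t) := by
  rw [polarAngleMeasure, withDensity_apply _ measurableSet_Ioi,
    Measure.restrict_restrict measurableSet_Ioi, Ioi_inter_Ioo, max_eq_left ht.1,
    ← ofReal_integral_eq_lintegral_ofReal, ← integral_Ioc_eq_integral_Ioo,
    ← intervalIntegral.integral_of_le ht.2, integral_sin, cos_pi, sub_neg_eq_add, add_comm]
  · exact continuous_sin.integrableOn_Icc.mono_set Ioo_subset_Icc_self
  · filter_upwards [ae_restrict_mem measurableSet_Ioo] with θ hθ
    exact (sin_pos_of_mem_Ioo ⟨ht.1.trans_lt hθ.1, hθ.2⟩).le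

theorem polarAngleMeasure_univ : polarAngleMeasure univ = 2 := by
  have : polarAngleMeasure (Ioi 0) = polarAngleMeasure univ := measure_congr <| by
    filter_upwards [ae_mem_Ioo_polarAngleMeasure] with θ hθ
    exact propext (iff_of_true hθ.1 trivial)
  rw [← this, polarAngleMeasure_Ioi ⟨le_rfl, pi_pos.le⟩, cos_zero]
  norm_num

theorem volume_cone_angle {x : Space} (hx : x ≠ 0) {B : Set ℝ} (hB : MeasurableSet B) :
    volume {y : Space | ‖y‖ ∈ Ioo 0 1 ∧ angle y x ∈ B}
      = ENNReal.ofReal (2 * π / 3) * polarAngleMeasure B := by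
  let G : ℝ → ℝ → ENNReal := fun r θ => (Ioo 0 1).indicator 1 r * B.indicator 1 θ
  have hG : Measurable (Function.uncurry G) :=
    ((measurable_one.indicator measurableSet_Ioo).comp measurable_fst).mul
      ((measurable_one.indicator hB).comp measurable_snd)
  have hcone : MeasurableSet {y : Space | ‖y‖ ∈ Ioo 0 1 ∧ angle y x ∈ B} :=
    (measurableSet_Ioo.preimage measurable_norm).inter (hB.preimage (measurable_angle_left x))
  have hradial : ∫⁻ r in Ioi (0 : ℝ), (Ioo 0 1).indicator (fun r => ENNReal.ofReal (r ^ 2)) r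
      = ENNReal.ofReal (1 / 3) := by
    rw [setLIntegral_indicator measurableSet_Ioo, inter_eq_left.2 Ioo_subset_Ioi_self,
      ← ofReal_integral_eq_lintegral_ofReal, ← integral_Ioc_eq_integral_Ioo,
      ← intervalIntegral.integral_of_le zero_le_one, integral_pow]
    · norm_num
    · exact (continuous_pow 2).integrableOn_Icc.mono_set Ioo_subset_Icc_self
    · exact ae_of_all _ fun _ => sq_nonneg _
  have hangular : ∀ r, ∫⁻ θ in Ioo 0 π, ENNReal.ofReal (r ^ 2 * sin θ) * G r θ
      = (Ioo 0 1).indicator (fun r => ENNReal.ofReal (r ^ 2)) r * polarAngleMeasure B := by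
    intro r
    rw [← lintegral_indicator_one hB, lintegral_polarAngleMeasure (measurable_one.indicator hB),
      ← lintegral_const_mul _ (by fun_prop (disch := assumption))]
    refine lintegral_congr fun θ => ?_
    by_cases hr : r ∈ Ioo 0 1 <;> simp [G, hr, ENNReal.ofReal_mul (sq_nonneg r), mul_assoc]
  calc volume {y : Space | ‖y‖ ∈ Ioo 0 1 ∧ angle y x ∈ B}
      = ∫⁻ y : Space, G ‖y‖ (angle y x) := by
        rw [← lintegral_indicator_one hcone]
        refine lintegral_congr fun y => ?_
        by_cases hr : ‖y‖ ∈ Ioo 0 1 <;> by_cases hθ : angle y x ∈ B <;>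
          simp [-mem_Ioo, indicator_apply, G, hr, hθ]
    _ = ENNReal.ofReal (2 * π) * (ENNReal.ofReal (1 / 3) * polarAngleMeasure B) := by
        rw [lintegral_spherical hx hG]
        simp_rw [hangular]
        rw [lintegral_mul_const _ (Measurable.indicator (by fun_prop) measurableSet_Ioo), hradial]
    _ = ENNReal.ofReal (2 * π / 3) * polarAngleMeasure B := by
        rw [← mul_assoc, ← ENNReal.ofReal_mul (by positivity), mul_one_div]

theorem map_angle_toSphere {x : Space} (hx : x ≠ 0) :
    (volume : Measure Space).toSphere.map
        (fun n : Metric.sphere (0 : Space) 1 => angle (n : Space) x)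
      = ENNReal.ofReal (2 * π) • polarAngleMeasure := by
  have hm : Measurable fun n : Metric.sphere (0 : Space) 1 => angle (n : Space) x :=
    (measurable_angle_left x).comp measurable_subtype_coe
  ext B hB
  have hcone : Ioo (0 : ℝ) 1 • (Subtype.val '' ((fun n : Metric.sphere (0 : Space) 1 =>
      angle (n : Space) x) ⁻¹' B)) = {y : Space | ‖y‖ ∈ Ioo 0 1 ∧ angle y x ∈ B} := by
    ext y
    constructor
    · rintro ⟨r, hr, _, ⟨n, hn, rfl⟩, rfl⟩
      have : ‖r • (n : Space)‖ = r := by simp [norm_smul, abs_of_pos hr.1]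
      exact ⟨this.symm ▸ hr, by simpa [angle_smul_left_of_pos _ _ hr.1] using hn⟩
    · rintro ⟨hy, hyB⟩
      refine ⟨‖y‖, hy, _, ⟨⟨‖y‖⁻¹ • y, ?_⟩, ?_, rfl⟩, ?_⟩
      · simp [norm_smul, hy.1.ne']
      · simpa [angle_smul_left_of_pos _ _ (inv_pos.2 hy.1)] using hyB
      · simp [smul_smul, hy.1.ne']
  rw [Measure.map_apply hm hB, Measure.toSphere_apply' _ (hm hB), hcone, volume_cone_angle hx hB,
    Measure.smul_apply, smul_eq_mul, ← mul_assoc]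
  congr 1
  rw [finrank_euclideanSpace_fin, Nat.cast_ofNat, ← ENNReal.ofReal_ofNat,
    ← ENNReal.ofReal_mul (by norm_num)]
  ring_nf

theorem map_angle_sphereArea {R : ℝ} (hR : 0 < R) {x : Space} (hx : x ≠ 0) :
    (sphereArea R).map (fun u => angle u x)
      = ENNReal.ofReal (2 * π * R ^ 2) • polarAngleMeasure := by
  have hscale : (fun u => angle u x) ∘ (fun n : Metric.sphere (0 : Space) 1 => R • (n : Space))
      = fun n : Metric.sphere (0 : Space) 1 => angle (n : Space) x :=
    funext fun n => angle_smul_left_of_pos _ _ hR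
  rw [sphereArea, Measure.map_smul, Measure.map_map (measurable_angle_left x) (by fun_prop), hscale,
    map_angle_toSphere hx, smul_smul, ← ENNReal.ofReal_mul (by positivity), mul_comm]

theorem sphereArea_univ {R : ℝ} (hR : 0 < R) :
    sphereArea R univ = ENNReal.ofReal (4 * π * R ^ 2) := by
  have hx : (EuclideanSpace.single (0 : Fin 3) (1 : ℝ) : Space) ≠ 0 := by simp
  have h := congrArg (· univ) (map_angle_sphereArea hR hx)
  simp only [Measure.map_apply (measurable_angle_left _) MeasurableSet.univ, preimage_univ,
    Measure.smul_apply, polarAngleMeasure_univ, smul_eq_mul] at h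
  rw [h, ← ENNReal.ofReal_ofNat, ← ENNReal.ofReal_mul (by positivity)]
  ring_nf

theorem isFiniteMeasure_sphereArea {R : ℝ} (hR : 0 < R) : IsFiniteMeasure (sphereArea R) :=
  ⟨by rw [sphereArea_univ hR]; exact ENNReal.ofReal_lt_top⟩

theorem hasLaw_angle_sphereUniform {R : ℝ} (hR : 0 < R) {x : Space} (hx : x ≠ 0) :
    HasLaw (fun u => angle u x) ((2 : ENNReal)⁻¹ • polarAngleMeasure) (sphereUniform R) where
  aemeasurable := (measurable_angle_left x).aemeasurable
  map_eq := by
    rw [sphereUniform, Measure.map_smul, map_angle_sphereArea hR hx, sphereArea_univ hR,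
      smul_smul, ← ENNReal.ofReal_inv_of_pos (by positivity), ← ENNReal.ofReal_mul (by positivity)]
    congr 1
    rw [← ENNReal.ofReal_ofNat, ← ENNReal.ofReal_inv_of_pos two_pos]
    congr 1
    field_simp
    norm_num

theorem ae_norm_eq_sphereArea {R : ℝ} (hR : 0 ≤ R) : ∀ᵐ u ∂(sphereArea R), ‖u‖ = R := by
  refine Measure.ae_smul_measure ?_ _
  rw [ae_map_iff (by fun_prop) (measurableSet_eq_fun (by fun_prop) (by fun_prop))]
  refine ae_of_all _ fun n => ?_
  rw [norm_smul, mem_sphere_zero_iff_norm.1 n.2, mul_one, Real.norm_of_nonneg hR]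

theorem ae_norm_eq_sphereUniform {R : ℝ} (hR : 0 ≤ R) : ∀ᵐ u ∂(sphereUniform R), ‖u‖ = R :=
  Measure.ae_smul_measure (ae_norm_eq_sphereArea hR) _

theorem integral_angle_sphereArea {R : ℝ} (hR : 0 < R) {x : Space} (hx : x ≠ 0)
    {g : ℝ → ℝ} (hg : Measurable g) :
    ∫ u, g (angle u x) ∂(sphereArea R) = 2 * π * R ^ 2 * ∫ θ in Ioo 0 π, g θ * sin θ := by
  rw [← integral_map (f := g) (measurable_angle_left x).aemeasurable hg.aestronglyMeasurable,
    map_angle_sphereArea hR hx, integral_smul_measure, polarAngleMeasure,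
    ENNReal.toReal_ofReal (by positivity), smul_eq_mul,
    integral_withDensity_eq_integral_toReal_smul (by fun_prop) (by simp)]
  congr 1
  refine setIntegral_congr_fun measurableSet_Ioo fun θ hθ => ?_
  rw [ENNReal.toReal_ofReal (sin_pos_of_mem_Ioo hθ).le, smul_eq_mul, mul_comm]

end Sphere

namespace Network

open InnerProductGeometry Set Real

variable {K : ℕ} (net : Network K) (m : Fin K)

section Geometry

theorem earthRadius_lt_orbitRadius : net.earthRadius < net.orbitRadius m :=
  lt_add_of_pos_left _ (net.altitude_pos m)

theorem orbitRadius_pos : 0 < net.orbitRadius m :=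
  net.earthRadius_pos.trans (net.earthRadius_lt_orbitRadius m)

theorem noise_pos : 0 < net.noise := mul_pos net.noiseDensity_pos net.bandwidth_pos

theorem norm_typicalDevice : ‖net.typicalDevice‖ = net.earthRadius := by
  rw [EuclideanSpace.norm_eq, Fin.sum_univ_three]
  simp [typicalDevice, sqrt_sq net.earthRadius_pos.le]

theorem typicalDevice_ne_zero : net.typicalDevice ≠ 0 := by
  rw [← norm_pos_iff, norm_typicalDevice]
  exact net.earthRadius_pos

theorem earthRadius_div_orbitRadius_mem_Ioo : net.earthRadius / net.orbitRadius m ∈ Ioo 0 1 :=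
  ⟨div_pos net.earthRadius_pos (net.orbitRadius_pos m),
    (div_lt_one (net.orbitRadius_pos m)).2 (net.earthRadius_lt_orbitRadius m)⟩

theorem thetaMax_pos : 0 < net.thetaMax m := by
  obtain ⟨hratio_pos, hratio_lt⟩ := net.earthRadius_div_orbitRadius_mem_Ioo m
  rw [thetaMax]
  split_ifs with hbeam
  · have hRe := net.earthRadius_pos
    have hRm := net.orbitRadius_pos m
    have hb0 := net.beam_pos
    have hbπ : net.beam < π / 2 := hbeam.trans_le (arcsin_le_pi_div_two _)
    have hsin_pos : 0 < sin net.beam := sin_pos_of_pos_of_lt_pi hb0 (by linarith)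
    have hsin_lt : sin net.beam < net.earthRadius / net.orbitRadius m :=
      (lt_arcsin_iff_sin_lt ⟨by linarith, hbπ.le⟩ ⟨by linarith, hratio_lt.le⟩).1 hbeam
    have hmem : net.orbitRadius m / net.earthRadius * sin net.beam ∈ Icc (-1) 1 := by
      refine ⟨neg_one_lt_zero.le.trans (by positivity), ?_⟩
      rw [lt_div_iff₀ hRm] at hsin_lt
      rw [div_mul_eq_mul_div, div_le_one hRe]
      linarith
    rw [sub_pos, lt_arcsin_iff_sin_lt ⟨by linarith, hbπ.le⟩ hmem, lt_mul_iff_one_lt_left hsin_pos]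
    exact (one_lt_div hRe).2 (net.earthRadius_lt_orbitRadius m)
  · exact arccos_pos.2 hratio_lt

theorem thetaMax_lt_pi : net.thetaMax m < π := by
  have := pi_pos
  rw [thetaMax]
  split_ifs
  · linarith [arcsin_le_pi_div_two (net.orbitRadius m / net.earthRadius * sin net.beam),
      net.beam_pos]
  · linarith [arccos_le_pi_div_two.2 (net.earthRadius_div_orbitRadius_mem_Ioo m).1.le]

theorem linkDistance_radicand_pos (θ : ℝ) : 0 < net.earthRadius ^ 2 + net.orbitRadius m ^ 2
    - 2 * net.earthRadius * net.orbitRadius m * cos θ := by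
  have := mul_pos net.earthRadius_pos (net.orbitRadius_pos m)
  nlinarith [cos_le_one θ, pow_pos (sub_pos.2 (net.earthRadius_lt_orbitRadius m)) 2]

theorem linkDistance_pos (θ : ℝ) : 0 < net.linkDistance m θ :=
  sqrt_pos.2 (net.linkDistance_radicand_pos m θ)

@[fun_prop]
theorem measurable_linkDistance : Measurable (net.linkDistance m) := by
  unfold linkDistance
  fun_prop

theorem strictMonoOn_linkDistance : StrictMonoOn (net.linkDistance m) (Icc 0 π) := by
  intro s hs t ht hst
  refine sqrt_lt_sqrt (net.linkDistance_radicand_pos m s).le ?_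
  have := mul_pos net.earthRadius_pos (net.orbitRadius_pos m)
  nlinarith [strictAntiOn_cos hs ht hst]

theorem dist_eq_linkDistance {u x : Space} (hu : ‖u‖ = net.earthRadius)
    (hx : ‖x‖ = net.orbitRadius m) : dist u x = net.linkDistance m (angle u x) := by
  rw [linkDistance, dist_eq_norm, eq_comm, sqrt_eq_iff_eq_sq
    (net.linkDistance_radicand_pos m _).le (norm_nonneg _), norm_sub_sq_real,
    ← cos_angle_mul_norm_mul_norm, hu, hx]
  ring

end Geometry

section ContactAngle

theorem contactPDF_nonneg {θ : ℝ} (hθ : θ ∈ Ioo 0 π) : 0 ≤ net.contactPDF m θ := by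
  have := sin_pos_of_mem_Ioo hθ
  have : 0 ≤ 1 + cos θ := by linarith [neg_one_le_cos θ]
  unfold contactPDF
  positivity

theorem continuous_contactPDF : Continuous (net.contactPDF m) := by
  unfold contactPDF
  fun_prop

theorem lintegral_contactPDF {b : ℝ} (hb : b ∈ Icc 0 π) :
    ∫⁻ θ in Ioo 0 b, ENNReal.ofReal (net.contactPDF m θ)
      = ENNReal.ofReal (1 - ((1 + cos b) / 2) ^ net.numSat m) := by
  have hderiv : ∀ θ, HasDerivAt (fun θ => -((1 + cos θ) / 2) ^ net.numSat m)
      (net.contactPDF m θ) θ := fun θ => by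
    convert! ((((hasDerivAt_cos θ).const_add 1).div_const 2).pow (net.numSat m)).neg using 1
    unfold contactPDF
    ring
  rw [← ofReal_integral_eq_lintegral_ofReal, ← integral_Ioc_eq_integral_Ioo,
    ← intervalIntegral.integral_of_le hb.1,
    intervalIntegral.integral_eq_sub_of_hasDerivAt (fun θ _ => hderiv θ)
      ((net.continuous_contactPDF m).intervalIntegrable _ _), cos_zero]
  · norm_num
    ring_nf
  · exact (net.continuous_contactPDF m).integrableOn_Icc.mono_set Ioo_subset_Icc_self
  · filter_upwards [ae_restrict_mem measurableSet_Ioo] with θ hθ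
    exact net.contactPDF_nonneg m ⟨hθ.1, hθ.2.trans_le hb.2⟩

theorem lintegral_contactPDF_mul {φ : ℝ → ENNReal} (hφ : Measurable φ) :
    ∫⁻ θ in Ioo 0 π, ENNReal.ofReal (net.contactPDF m θ) * φ θ
      = net.numSat m *
        ∫⁻ t, φ t * ((2 : ENNReal)⁻¹ • polarAngleMeasure) (Ioi t) ^ (net.numSat m - 1)
          ∂((2 : ENNReal)⁻¹ • polarAngleMeasure) := by
  symm
  have htail : ∀ᵐ t ∂polarAngleMeasure, ((2 : ENNReal)⁻¹ • polarAngleMeasure) (Ioi t)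
      = ENNReal.ofReal ((1 + cos t) / 2) := by
    filter_upwards [ae_mem_Ioo_polarAngleMeasure] with t ht
    rw [Measure.smul_apply, polarAngleMeasure_Ioi ⟨ht.1.le, ht.2.le⟩, smul_eq_mul, mul_comm,
      ENNReal.ofReal_div_of_pos two_pos, ENNReal.ofReal_ofNat, div_eq_mul_inv]
  have hhalf : (2 : ENNReal)⁻¹ = ENNReal.ofReal (1 / 2) := by
    rw [one_div, ENNReal.ofReal_inv_of_pos two_pos, ENNReal.ofReal_ofNat]
  rw [lintegral_smul_measure, lintegral_congr_ae (htail.mono fun t ht => by rw [ht]),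
    lintegral_polarAngleMeasure (by fun_prop), smul_eq_mul, ← mul_assoc,
    ← lintegral_const_mul _ (by fun_prop)]
  refine setLIntegral_congr_fun measurableSet_Ioo fun θ hθ => ?_
  have hsin := (sin_pos_of_mem_Ioo hθ).le
  have hcos : 0 ≤ (1 + cos θ) / 2 := by linarith [neg_one_le_cos θ]
  rw [mul_left_comm (ENNReal.ofReal (sin θ)), mul_left_comm, mul_comm _ (φ θ),
    ← ENNReal.ofReal_pow hcos, ← ENNReal.ofReal_mul hsin, hhalf, ← ENNReal.ofReal_natCast,
    ← ENNReal.ofReal_mul (by positivity), ← ENNReal.ofReal_mul (by positivity), contactPDF]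
  ring_nf

theorem availability_nonneg : 0 ≤ net.availability m := by
  refine sub_nonneg.2 (pow_le_one₀ ?_ ?_)
  · linarith [neg_one_le_cos (net.thetaMax m)]
  · linarith [cos_le_one (net.thetaMax m)]

end ContactAngle

section ReceivedPower

theorem receivedPower_eq_mul (u x : Space) (g : ℝ) :
    net.receivedPower m u x g = net.receivedPower m u x 1 * g := by
  unfold receivedPower
  split_ifs <;> ring

theorem receivedPower_nonneg (u x : Space) {g : ℝ} (hg : 0 ≤ g) :
    0 ≤ net.receivedPower m u x g := by
  have := net.power_pos
  have := net.gain_pos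
  unfold receivedPower
  split_ifs <;> positivity

theorem measurable_receivedPower :
    Measurable fun q : Space × Space × ℝ => net.receivedPower m q.1 q.2.1 q.2.2 := by
  unfold receivedPower angle
  exact Measurable.ite (measurableSet_lt (by fun_prop) measurable_const) (by fun_prop)
    measurable_const

/-- The factor by which interference plus noise is multiplied to give the least fading power of
the typical device at which it is covered. -/
def thresholdScale (θ : ℝ) : ℝ :=
  net.β / (net.γ * net.power * net.gain) *
    (4 * π * net.freq * net.linkDistance m θ / net.c) ^ 2

theorem sLS_eq (θ : ℝ) : net.sLS m θ = net.fadingRate * net.thresholdScale m θ := by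
  unfold sLS thresholdScale
  ring

theorem fadingRate_pos : 0 < net.fadingRate :=
  div_pos (rpow_pos_of_pos (by exact_mod_cast net.m₁.factorial_pos) _) net.m₂_pos

theorem thresholdScale_pos (θ : ℝ) : 0 < net.thresholdScale m θ := by
  have := net.β_pos; have := net.γ_pos; have := net.power_pos; have := net.gain_pos
  have := net.freq_pos; have := net.c_pos; have := net.linkDistance_pos m θ
  unfold thresholdScale
  positivity

@[fun_prop]
theorem measurable_thresholdScale : Measurable (net.thresholdScale m) := by
  unfold thresholdScale
  fun_prop

@[fun_prop]
theorem measurable_sLS : Measurable (net.sLS m) := by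
  unfold sLS
  fun_prop

theorem sLS_pos (θ : ℝ) : 0 < net.sLS m θ := by
  rw [sLS_eq]
  exact mul_pos net.fadingRate_pos (net.thresholdScale_pos m θ)

theorem lt_receivedPower_typicalDevice_div_iff {x : Space} (hx : ‖x‖ = net.orbitRadius m)
    {D : ℝ} (hD : 0 < D) (g : ℝ) :
    net.β < net.γ * net.receivedPower m net.typicalDevice x g / D ↔
      angle x net.typicalDevice < net.thetaMax m ∧
        net.thresholdScale m (angle x net.typicalDevice) * D < g := by
  have := net.β_pos; have := net.γ_pos; have := net.power_pos; have := net.gain_pos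
  have := net.freq_pos; have := net.c_pos
  have := net.linkDistance_pos m (angle x net.typicalDevice)
  rw [receivedPower, net.dist_eq_linkDistance m net.norm_typicalDevice hx,
    angle_comm net.typicalDevice x]
  split_ifs with hθ
  · let p : ℝ := net.γ * (net.power * (net.c / (4 * π * net.freq *
      net.linkDistance m (angle x net.typicalDevice))) ^ 2 * net.gain)
    have hp : 0 < p := by positivity
    have hscale : net.thresholdScale m (angle x net.typicalDevice) = net.β / p := by
      simp only [thresholdScale, p]
      field_simp
    rw [← mul_assoc net.γ, lt_div_iff₀ hD, hscale, div_mul_eq_mul_div, div_lt_iff₀' hp,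
      and_iff_right hθ]
  · simp [hθ, net.β_pos.le]

end ReceivedPower

section Interference

/-- The interference at a satellite at `x` of a finite configuration of devices: `d.1.1` is their
number, and their positions and fading powers are the terms of `d.1.2` and `d.2` with indices
`1, …, d.1.1`. -/
def interferenceAt (x : Space) (d : (ℕ × (ℕ → Space)) × (ℕ → ℝ)) : ℝ :=
  ∑ i ∈ Finset.Icc 1 d.1.1, net.receivedPower m (d.1.2 i) x (d.2 i)

@[fun_prop]
theorem measurable_interferenceAt :
    Measurable fun q : Space × (ℕ × (ℕ → Space)) × (ℕ → ℝ) => net.interferenceAt m q.1 q.2 :=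
  measurable_comp_nat
    (F := fun N (q : Space × (ℕ × (ℕ → Space)) × (ℕ → ℝ)) =>
      ∑ i ∈ Finset.Icc 1 N, net.receivedPower m (q.2.1.2 i) q.1 (q.2.2 i))
    (fun N => Finset.measurable_fun_sum _ fun i _ => (net.measurable_receivedPower m).comp
      (f := fun q : Space × (ℕ × (ℕ → Space)) × (ℕ → ℝ) => (q.2.1.2 i, q.1, q.2.2 i))
      (by fun_prop)) (by fun_prop)

theorem interferenceAt_nonneg (x : Space) {d : (ℕ × (ℕ → Space)) × (ℕ → ℝ)}
    (hd : ∀ i, i ≠ 0 → 0 ≤ d.2 i) : 0 ≤ net.interferenceAt m x d :=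
  Finset.sum_nonneg fun i hi => net.receivedPower_nonneg m _ _ (hd i (by grind))

/-- The Laplace transform of the power received from an interfering device at central angle `θ`,
for `θ` below `thetaMax`. -/
def receivedPowerLT (s θ : ℝ) : ℝ :=
  (1 + net.m₂ * s * net.power * net.gain *
    (net.c / (4 * π * net.freq * net.linkDistance m θ)) ^ 2) ^ (-(net.m₁ : ℤ))

@[fun_prop]
theorem measurable_receivedPowerLT :
    Measurable fun q : ℝ × ℝ => net.receivedPowerLT m q.1 q.2 := by
  simp only [receivedPowerLT, zpow_neg, zpow_natCast]
  fun_prop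

theorem one_sub_lintegral_exp_neg_mul_receivedPower {u x : Space} (hu : ‖u‖ = net.earthRadius)
    (hx : ‖x‖ = net.orbitRadius m) {s : ℝ} (hs : 0 ≤ s) :
    1 - (∫⁻ g, ENNReal.ofReal (exp (-(s * net.receivedPower m u x g)))
        ∂(gammaMeasure (net.m₁ : ℝ) (1 / net.m₂))).toReal
      = (Iio (net.thetaMax m)).indicator (fun θ => 1 - net.receivedPowerLT m s θ) (angle u x) := by
  have hm₂ := net.m₂_pos
  have hb : 0 ≤ s * net.receivedPower m u x 1 :=
    mul_nonneg hs (net.receivedPower_nonneg m u x zero_le_one)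
  have hlin : ∀ g, ENNReal.ofReal (exp (-(s * net.receivedPower m u x g)))
      = ENNReal.ofReal (exp (-(s * net.receivedPower m u x 1 * g))) := fun g => by
    rw [net.receivedPower_eq_mul m u x g, mul_assoc]
  rw [lintegral_congr hlin, lintegral_exp_neg_mul_gammaMeasure (Nat.cast_pos.2 net.m₁_pos)
    (one_div_pos.2 hm₂) ((neg_lt_zero.2 (one_div_pos.2 hm₂)).trans_le hb),
    ENNReal.toReal_ofReal (by positivity), rpow_neg (by positivity), rpow_natCast,
    ← zpow_natCast, ← zpow_neg, receivedPower, net.dist_eq_linkDistance m hu hx]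
  by_cases hθ : angle u x < net.thetaMax m
  · rw [if_pos hθ, indicator_of_mem (mem_Iio.2 hθ), receivedPowerLT]
    congr 3
    field_simp
  · rw [if_neg hθ, indicator_of_notMem (mt mem_Iio.1 hθ)]
    simp

theorem lintegral_exp_neg_mul_receivedPower_le_one (u x : Space) {s : ℝ} (hs : 0 ≤ s) :
    ∫⁻ g, ENNReal.ofReal (exp (-(s * net.receivedPower m u x g)))
      ∂(gammaMeasure (net.m₁ : ℝ) (1 / net.m₂)) ≤ 1 := by
  have := isProbabilityMeasure_gammaMeasure (Nat.cast_pos.2 net.m₁_pos) (one_div_pos.2 net.m₂_pos)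
  refine (lintegral_mono_ae (g := fun _ => 1) ?_).trans
    (by rw [lintegral_one, measure_univ])
  filter_upwards [ae_nonneg_gammaMeasure _ _] with g hg
  exact ENNReal.ofReal_le_one.2 (exp_le_one_iff.2 (neg_nonpos.2
    (mul_nonneg hs (net.receivedPower_nonneg m u x hg))))

theorem interferenceLT_eq_exp_neg_integral {x : Space} (hx : x ≠ 0) (s : ℝ) :
    net.interferenceLT m s = exp (-∫ u, (Iio (net.thetaMax m)).indicator
      (fun θ => 1 - net.receivedPowerLT m s θ) (angle u x)
        ∂(ENNReal.ofReal net.density • sphereArea net.earthRadius)) := by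
  have hm : Measurable ((Iio (net.thetaMax m)).indicator fun θ => 1 - net.receivedPowerLT m s θ) :=
    Measurable.indicator (by fun_prop) measurableSet_Iio
  have hcut : ∫ θ in Ioo 0 π, (Iio (net.thetaMax m)).indicator
        (fun θ => 1 - net.receivedPowerLT m s θ) θ * sin θ
      = ∫ θ in Ioo 0 (net.thetaMax m), (1 - net.receivedPowerLT m s θ) * sin θ := by
    simp_rw [← indicator_mul_left _ _ sin]
    rw [setIntegral_indicator measurableSet_Iio, Ioo_inter_Iio,
      min_eq_right (net.thetaMax_lt_pi m).le]
  rw [integral_smul_measure, ENNReal.toReal_ofReal net.density_pos.le,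
    integral_angle_sphereArea net.earthRadius_pos hx hm, hcut, interferenceLT,
    intervalIntegral.integral_const, intervalIntegral.integral_of_le (net.thetaMax_pos m).le,
    integral_Ioc_eq_integral_Ioo]
  simp_rw [mul_left_comm _ (net.earthRadius ^ 2), integral_const_mul, smul_eq_mul, sub_zero,
    mul_assoc (2 * π), receivedPowerLT]

theorem interferenceLT_pos (s : ℝ) : 0 < net.interferenceLT m s := exp_pos _

@[fun_prop]
theorem measurable_interferenceLT : Measurable (net.interferenceLT m) := by
  have hinner : Measurable fun s => ∫ θ in Ioc 0 (net.thetaMax m),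
      (1 - net.receivedPowerLT m s θ) * (net.earthRadius ^ 2 * sin θ) :=
    (StronglyMeasurable.integral_prod_right'
      (f := fun q : ℝ × ℝ => (1 - net.receivedPowerLT m q.1 q.2) * (net.earthRadius ^ 2 * sin q.2))
      (Measurable.stronglyMeasurable (by fun_prop))).measurable
  unfold interferenceLT
  simp only [intervalIntegral.integral_const,
    intervalIntegral.integral_of_le (net.thetaMax_pos m).le]
  exact ((hinner.const_smul (2 * π - 0)).const_mul _).neg.exp

end Interference

section ApproxCDF

theorem one_sub_approxCDF (t : ℝ) : 1 - net.approxCDF t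
    = ∑ q ∈ Finset.Icc 1 net.m₁, (net.m₁.choose q : ℝ) * (-1) ^ (q + 1) *
        exp (-(q * net.fadingRate * t)) := by
  have hbinom : net.approxCDF t = ∑ q ∈ Finset.range (net.m₁ + 1),
      (net.m₁.choose q : ℝ) * (-1) ^ q * exp (-(q * net.fadingRate * t)) := by
    rw [approxCDF, sub_eq_neg_add, add_pow]
    refine Finset.sum_congr rfl fun q _ => ?_
    rw [neg_pow, ← exp_nat_mul, one_pow]
    ring_nf
  rw [hbinom, Finset.range_eq_Ico, Finset.sum_eq_sum_Ico_succ_bot net.m₁.succ_pos]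
  simp [pow_succ, Finset.Ico_add_one_right_eq_Icc]

theorem cdf_gammaMeasure_eq_approxCDF (h1 : net.m₁ = 1) {x : ℝ} (hx : 0 ≤ x) :
    cdf (gammaMeasure (net.m₁ : ℝ) (1 / net.m₂)) x = net.approxCDF x := by
  have h := cdf_expMeasure_eq (one_div_pos.2 net.m₂_pos) x
  rw [expMeasure, if_pos hx] at h
  simpa [approxCDF, fadingRate, h1] using h

end ApproxCDF

end Network

namespace Network

open InnerProductGeometry Set Real

variable {K : ℕ} (net : Network K) (m : Fin K)

section NearestSatellite

/-- The configurations of the satellites in which satellite `j` is strictly nearest, in central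
angle, to the typical device. -/
def nearestSet (j : Fin (net.numSat m)) : Set (Fin (net.numSat m) → Space) :=
  {x | ∀ i, i ≠ j → angle (x j) net.typicalDevice < angle (x i) net.typicalDevice}

/-- The configurations in which satellite `j` is strictly nearest to the typical device and linked
to it. -/
def linkedSet (j : Fin (net.numSat m)) : Set (Fin (net.numSat m) → Space) :=
  net.nearestSet m j ∩ {x | angle (x j) net.typicalDevice < net.thetaMax m}

variable {m}

/-- The least fading power of the typical device at which satellite `j` covers it, when the
satellites are at `x` and the interfering devices are described by `d`. -/
def thresholdAt (j : Fin (net.numSat m)) (x : Fin (net.numSat m) → Space)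
    (d : (ℕ × (ℕ → Space)) × (ℕ → ℝ)) : ℝ :=
  net.thresholdScale m (angle (x j) net.typicalDevice) *
    (net.interferenceAt m (x j) d + net.noise)

theorem measurable_angle_apply_typicalDevice (j : Fin (net.numSat m)) :
    Measurable fun x : Fin (net.numSat m) → Space => angle (x j) net.typicalDevice :=
  (measurable_angle_left _).comp (measurable_pi_apply j)

theorem measurable_thresholdAt (j : Fin (net.numSat m)) :
    Measurable fun q : (Fin (net.numSat m) → Space) × (ℕ × (ℕ → Space)) × (ℕ → ℝ) =>
      net.thresholdAt j q.1 q.2 := by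
  have hθ : Measurable fun q : (Fin (net.numSat m) → Space) × (ℕ × (ℕ → Space)) × (ℕ → ℝ) =>
      angle (q.1 j) net.typicalDevice :=
    (net.measurable_angle_apply_typicalDevice j).comp measurable_fst
  unfold thresholdAt
  fun_prop

theorem measurableSet_nearestSet (j : Fin (net.numSat m)) :
    MeasurableSet (net.nearestSet m j) := by
  simp only [nearestSet, Set.ofPred_forall]
  exact MeasurableSet.iInter fun i => MeasurableSet.iInter fun _ => measurableSet_lt
    (net.measurable_angle_apply_typicalDevice j) (net.measurable_angle_apply_typicalDevice i)

theorem measurableSet_linkedSet (j : Fin (net.numSat m)) : MeasurableSet (net.linkedSet m j) :=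
  (net.measurableSet_nearestSet j).inter
    (measurableSet_lt (net.measurable_angle_apply_typicalDevice j) measurable_const)

theorem pairwise_disjoint_nearestSet :
    Pairwise (Function.onFun Disjoint (net.nearestSet m)) := fun i j hij =>
  Set.disjoint_left.2 fun _ hi hj => lt_asymm (hi j hij.symm) (hj i hij)

end NearestSatellite

end Network

namespace Uplink

open InnerProductGeometry Set Real

variable {K : ℕ} {net : Network K} {m : Fin K} {ν : Measure ℝ}
  {Ω : Type*} [MeasurableSpace Ω] {μ : Measure Ω} (S : Uplink net m ν μ)

section Environment

/-- The configuration of the satellites. -/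
def satConfig (ω : Ω) (j : Fin (net.numSat m)) : Space := S.sat j ω

/-- The number, positions and fading powers of the interfering devices. The fading power of the
typical device, which does not enter the interference, is replaced by `0`, so that these data are
independent of it. -/
def interferers (ω : Ω) : (ℕ × (ℕ → Space)) × (ℕ → ℝ) :=
  ((S.numDev ω, fun i => S.dev i ω), Function.update (fun i => S.fading i ω) 0 0)

theorem measurable_satConfig : Measurable S.satConfig :=
  measurable_pi_lambda _ S.sat_measurable

theorem measurable_devices : Measurable fun ω => (S.numDev ω, fun i => S.dev i ω) :=
  S.dev_poisson.measurable_num.prodMk (measurable_pi_lambda _ S.dev_poisson.measurable_point)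

theorem measurable_fadings : Measurable fun ω i => S.fading i ω :=
  measurable_pi_lambda _ S.fading_measurable

theorem measurable_interferers : Measurable S.interferers :=
  S.measurable_devices.prodMk ((measurable_update_left (a := 0)).comp S.measurable_fadings)

theorem indepFun_satConfig_interferers : IndepFun S.satConfig S.interferers μ := by
  have := S.sat_indep.isProbabilityMeasure
  exact (indepFun_prodMk_assoc S.measurable_satConfig S.measurable_devices S.measurable_fadings
    S.indep_sat_dev S.indep_fading.symm).comp measurable_id
      (measurable_id.prodMap (measurable_update_left (a := 0)))

theorem indepFun_environment_fading_zero :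
    IndepFun (fun ω => (S.satConfig ω, S.interferers ω)) (S.fading 0) μ := by
  have := S.sat_indep.isProbabilityMeasure
  have hfading : IndepFun (S.fading 0) (fun ω => (Function.update (fun i => S.fading i ω) 0 0,
      S.satConfig ω, S.numDev ω, fun i => S.dev i ω)) μ :=
    indepFun_prodMk_assoc (S.fading_measurable 0)
      ((measurable_update_left (a := 0)).comp S.measurable_fadings)
      (S.measurable_satConfig.prodMk S.measurable_devices)
      (indepFun_update_of_iIndepFun S.fading_measurable S.fading_indep 0 0)
      (S.indep_fading.comp (φ := fun g : ℕ → ℝ => (g 0, Function.update g 0 0))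
        ((measurable_pi_apply 0).prodMk measurable_update_left) measurable_id)
  exact (hfading.comp (ψ := fun q : (ℕ → ℝ) × (Fin (net.numSat m) → Space) × ℕ × (ℕ → Space) =>
    (q.2.1, q.2.2, q.1)) measurable_id (by fun_prop)).symm

theorem ae_norm_sat : ∀ᵐ ω ∂μ, ∀ j, ‖S.sat j ω‖ = net.orbitRadius m :=
  ae_all_iff.2 fun j => ((S.sat_law j).ae_iff (by fun_prop)).2
    (ae_norm_eq_sphereUniform (net.orbitRadius_pos m).le)

theorem ae_fading_nonneg : ∀ᵐ ω ∂μ, ∀ i, i ≠ 0 → 0 ≤ S.fading i ω := by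
  simp_rw [ae_all_iff]
  exact fun i hi => ((S.fading_law i hi).ae_iff (by fun_prop)).2 (ae_nonneg_gammaMeasure _ _)

end Environment

section Interference

theorem interference_eq (ω : Ω) :
    S.interference ω = net.interferenceAt m (S.sat (S.serving ω) ω) (S.interferers ω) :=
  Finset.sum_congr rfl fun i hi => by
    simp only [power, interferers]
    rw [Function.update_of_ne (by grind)]

theorem ae_interferenceAt_nonneg : ∀ᵐ ω ∂μ, ∀ x, 0 ≤ net.interferenceAt m x (S.interferers ω) := by
  filter_upwards [S.ae_fading_nonneg] with ω hω x
  refine net.interferenceAt_nonneg m x fun i hi => ?_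
  simpa only [interferers, Function.update_of_ne hi] using hω i hi

theorem lintegral_exp_neg_mul_interferenceAt {x : Space}
    (hx : ‖x‖ = net.orbitRadius m) {s : ℝ} (hs : 0 ≤ s) :
    ∫⁻ d, ENNReal.ofReal (exp (-(s * net.interferenceAt m x d))) ∂(μ.map S.interferers)
      = ENNReal.ofReal (net.interferenceLT m s) := by
  let φ : Space → ℝ → ENNReal := fun u g =>
    ENNReal.ofReal (exp (-(s * net.receivedPower m u x g)))
  have hφ : Measurable (Function.uncurry φ) :=
    (((net.measurable_receivedPower m).comp (f := fun q : Space × ℝ => (q.1, x, q.2))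
      (by fun_prop)).const_mul s).neg.exp.ennreal_ofReal
  have hprod : ∀ ω, ENNReal.ofReal (exp (-(s * net.interferenceAt m x (S.interferers ω))))
      = ∏ i ∈ Finset.Icc 1 (S.numDev ω), φ (S.dev i ω) (S.fading i ω) := fun ω => by
    rw [Network.interferenceAt, Finset.mul_sum, ← Finset.sum_neg_distrib, exp_sum,
      ENNReal.ofReal_prod_of_nonneg fun _ _ => (exp_pos _).le]
    refine Finset.prod_congr rfl fun i hi => ?_
    simp only [φ, interferers]
    rw [Function.update_of_ne (by grind)]
  have := S.sat_indep.isProbabilityMeasure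
  have := isFiniteMeasure_sphereArea net.earthRadius_pos
  have : IsFiniteMeasure (ENNReal.ofReal net.density • sphereArea net.earthRadius) :=
    Measure.smul_finite _ ENNReal.ofReal_ne_top
  have := isProbabilityMeasure_gammaMeasure (Nat.cast_pos.2 net.m₁_pos) (one_div_pos.2 net.m₂_pos)
  rw [lintegral_map (by fun_prop) S.measurable_interferers, lintegral_congr hprod,
    S.dev_poisson.lintegral_prod_marks S.fading_measurable S.fading_law S.fading_indep
      (S.indep_fading.symm.comp measurable_snd measurable_id) hφ
      fun u => net.lintegral_exp_neg_mul_receivedPower_le_one m u x hs,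
    net.interferenceLT_eq_exp_neg_integral m (norm_pos_iff.1 (hx ▸ net.orbitRadius_pos m))]
  congr 3
  refine integral_congr_ae (Measure.ae_smul_measure ?_ _)
  filter_upwards [ae_norm_eq_sphereArea net.earthRadius_pos.le] with u hu
  exact net.one_sub_lintegral_exp_neg_mul_receivedPower m hu hx hs

end Interference

section ContactAngle

/-- The central angle between the typical device and satellite `j`. -/
def contactAngle (j : Fin (net.numSat m)) (ω : Ω) : ℝ := angle (S.sat j ω) net.typicalDevice

theorem measurable_contactAngle (j : Fin (net.numSat m)) : Measurable (S.contactAngle j) :=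
  (measurable_angle_left _).comp (S.sat_measurable j)

theorem measurableSet_linked (j : Fin (net.numSat m)) :
    MeasurableSet (S.satConfig ⁻¹' net.linkedSet m j) :=
  S.measurable_satConfig (net.measurableSet_linkedSet j)

theorem sum_setLIntegral_nearest {φ : ℝ → ENNReal} (hφ : Measurable φ) :
    ∑ j, ∫⁻ ω in S.satConfig ⁻¹' net.nearestSet m j, φ (S.contactAngle j ω) ∂μ
      = ∫⁻ θ in Ioo 0 π, ENNReal.ofReal (net.contactPDF m θ) * φ θ := by
  have := S.sat_indep.isProbabilityMeasure
  have hlaw : ∀ j, HasLaw (S.contactAngle j) ((2 : ENNReal)⁻¹ • polarAngleMeasure) μ := fun j =>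
    (hasLaw_angle_sphereUniform (net.orbitRadius_pos m) net.typicalDevice_ne_zero).fun_comp
      (S.sat_law j)
  have hindep : iIndepFun S.contactAngle μ :=
    S.sat_indep.comp _ fun _ => measurable_angle_left net.typicalDevice
  have hj := fun j => setLIntegral_forall_lt_of_iIndepFun hlaw hindep j hφ
  rw [net.lintegral_contactPDF_mul m hφ]
  refine (Finset.sum_congr rfl fun j _ => hj j).trans ?_
  simp

theorem sum_setLIntegral_linked {φ : ℝ → ENNReal} (hφ : Measurable φ) :
    ∑ j, ∫⁻ ω in S.satConfig ⁻¹' net.linkedSet m j, φ (S.contactAngle j ω) ∂μ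
      = ∫⁻ θ in Ioo 0 (net.thetaMax m), ENNReal.ofReal (net.contactPDF m θ) * φ θ := by
  have hcut : ∀ j, ∫⁻ ω in S.satConfig ⁻¹' net.linkedSet m j, φ (S.contactAngle j ω) ∂μ
      = ∫⁻ ω in S.satConfig ⁻¹' net.nearestSet m j,
          (Iio (net.thetaMax m)).indicator φ (S.contactAngle j ω) ∂μ := fun j => by
    rw [Network.linkedSet, preimage_inter, inter_comm]
    exact (setLIntegral_indicator (S.measurable_contactAngle j measurableSet_Iio) _).symm
  simp_rw [hcut]
  rw [S.sum_setLIntegral_nearest (hφ.indicator measurableSet_Iio)]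
  have hmul : ∀ θ, ENNReal.ofReal (net.contactPDF m θ) * (Iio (net.thetaMax m)).indicator φ θ
      = (Iio (net.thetaMax m)).indicator (fun θ => ENNReal.ofReal (net.contactPDF m θ) * φ θ) θ :=
    fun _ => (indicator_mul_right _ (fun θ => ENNReal.ofReal (net.contactPDF m θ)) φ).symm
  simp_rw [hmul]
  rw [setLIntegral_indicator measurableSet_Iio, inter_comm, Ioo_inter_Iio,
    min_eq_right (net.thetaMax_lt_pi m).le]

theorem ae_exists_mem_nearestSet : ∀ᵐ ω ∂μ, ∃ j, S.satConfig ω ∈ net.nearestSet m j := by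
  have := S.sat_indep.isProbabilityMeasure
  have hm : ∀ j, MeasurableSet (S.satConfig ⁻¹' net.nearestSet m j) := fun j =>
    S.measurable_satConfig (net.measurableSet_nearestSet j)
  have hprob : μ (⋃ j, S.satConfig ⁻¹' net.nearestSet m j) = 1 := by
    have hsum := S.sum_setLIntegral_nearest (φ := fun _ => 1) measurable_const
    simp only [mul_one, setLIntegral_one] at hsum
    rw [measure_iUnion (fun i j hij => (net.pairwise_disjoint_nearestSet hij).preimage _) hm,
      tsum_fintype, hsum, net.lintegral_contactPDF m ⟨pi_pos.le, le_rfl⟩]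
    simp [(net.numSat_pos m).ne']
  filter_upwards [measure_eq_zero_iff_ae_notMem.1
    ((prob_compl_eq_zero_iff (MeasurableSet.iUnion hm)).2 hprob)] with ω hω
  simpa using hω

theorem serving_eq {ω : Ω} {j : Fin (net.numSat m)}
    (hn : ∀ j, ‖S.sat j ω‖ = net.orbitRadius m) (hj : S.satConfig ω ∈ net.nearestSet m j) :
    S.serving ω = j := by
  by_contra hne
  have hdist : ∀ i, dist net.typicalDevice (S.sat i ω)
      = net.linkDistance m (S.contactAngle i ω) := fun i => by
    rw [net.dist_eq_linkDistance m net.norm_typicalDevice (hn i), angle_comm, contactAngle]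
  have hmem : ∀ i, S.contactAngle i ω ∈ Icc 0 π := fun i => ⟨angle_nonneg _ _, angle_le_pi _ _⟩
  have hle := S.serving_nearest ω j
  rw [hdist, hdist, (net.strictMonoOn_linkDistance m).le_iff_le (hmem _) (hmem _)] at hle
  exact hle.not_gt (hj _ hne)

end ContactAngle

section Threshold

/-- The random threshold of satellite `j`. -/
def threshold (j : Fin (net.numSat m)) (ω : Ω) : ℝ :=
  net.thresholdAt j (S.satConfig ω) (S.interferers ω)

/-- The law of the threshold at the serving satellite, on the event that the typical device is
linked to it; its total mass is the probability of that event. -/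
def thresholdMeasure : Measure ℝ :=
  ∑ j, (μ.restrict (S.satConfig ⁻¹' net.linkedSet m j)).map (S.threshold j)

theorem measurable_threshold (j : Fin (net.numSat m)) : Measurable (S.threshold j) :=
  (net.measurable_thresholdAt j).comp
    (f := fun ω => (S.satConfig ω, S.interferers ω))
    (S.measurable_satConfig.prodMk S.measurable_interferers)

theorem lintegral_thresholdMeasure {f : ℝ → ENNReal} (hf : Measurable f) :
    ∫⁻ t, f t ∂S.thresholdMeasure
      = ∑ j, ∫⁻ ω in S.satConfig ⁻¹' net.linkedSet m j, f (S.threshold j ω) ∂μ := by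
  rw [thresholdMeasure, lintegral_finsetSum_measure]
  exact Finset.sum_congr rfl fun j _ => lintegral_map hf (S.measurable_threshold j)

theorem thresholdMeasure_univ :
    S.thresholdMeasure univ = ENNReal.ofReal (net.availability m) := by
  rw [← lintegral_one, S.lintegral_thresholdMeasure measurable_const,
    S.sum_setLIntegral_linked (φ := fun _ => 1) measurable_const]
  simp only [mul_one]
  exact net.lintegral_contactPDF m ⟨(net.thetaMax_pos m).le, (net.thetaMax_lt_pi m).le⟩

instance isFiniteMeasure_thresholdMeasure : IsFiniteMeasure S.thresholdMeasure :=
  ⟨by rw [S.thresholdMeasure_univ]; exact ENNReal.ofReal_lt_top⟩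

theorem ae_thresholdMeasure_nonneg : ∀ᵐ t ∂S.thresholdMeasure, 0 ≤ t := by
  rw [ae_iff, thresholdMeasure, Measure.coe_finsetSum, Finset.sum_apply]
  refine Finset.sum_eq_zero fun j _ => ?_
  rw [← ae_iff, ae_map_iff (S.measurable_threshold j).aemeasurable measurableSet_Ici]
  filter_upwards [ae_restrict_of_ae S.ae_interferenceAt_nonneg] with ω hI
  exact mul_nonneg (net.thresholdScale_pos m _).le (add_nonneg (hI _) net.noise_pos.le)

theorem lt_sinr_iff {ω : Ω} {j : Fin (net.numSat m)}
    (hn : ∀ j, ‖S.sat j ω‖ = net.orbitRadius m)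
    (hI : ∀ x, 0 ≤ net.interferenceAt m x (S.interferers ω))
    (hj : S.satConfig ω ∈ net.nearestSet m j) :
    net.β < S.sinr ω ↔ S.satConfig ω ∈ net.linkedSet m j ∧ S.threshold j ω < S.fading 0 ω := by
  rw [sinr, power, S.interference_eq, S.dev_zero, S.serving_eq hn hj,
    net.lt_receivedPower_typicalDevice_div_iff m (hn j)
      (add_pos_of_nonneg_of_pos (hI _) net.noise_pos)]
  exact and_congr_left' (and_iff_right hj).symm

theorem measure_linked_inter (j : Fin (net.numSat m)) :
    μ (S.satConfig ⁻¹' net.linkedSet m j ∩ {ω | S.threshold j ω < S.fading 0 ω})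
      = ∫⁻ ω in S.satConfig ⁻¹' net.linkedSet m j, ν (Ioi (S.threshold j ω)) ∂μ := by
  have := S.sat_indep.isProbabilityMeasure
  exact measure_preimage_inter_lt_of_indepFun
    (S.measurable_satConfig.prodMk S.measurable_interferers) S.fading_zero_law
    (S.fading_measurable 0) S.indepFun_environment_fading_zero
    (measurable_fst (net.measurableSet_linkedSet j)) (net.measurable_thresholdAt j)

theorem measure_covered : μ {ω | net.β < S.sinr ω} = ∫⁻ t, ν (Ioi t) ∂S.thresholdMeasure := by
  have hν : Measurable fun t => ν (Ioi t) :=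
    Antitone.measurable fun s t hst => measure_mono (Ioi_subset_Ioi hst)
  rw [S.lintegral_thresholdMeasure hν]
  simp_rw [← S.measure_linked_inter]
  have hdisj : Pairwise (Function.onFun Disjoint fun j =>
      S.satConfig ⁻¹' net.linkedSet m j ∩ {ω | S.threshold j ω < S.fading 0 ω}) := fun i j hij =>
    ((net.pairwise_disjoint_nearestSet hij).preimage S.satConfig).mono
      (inter_subset_left.trans (preimage_mono inter_subset_left))
      (inter_subset_left.trans (preimage_mono inter_subset_left))
  rw [← tsum_fintype (L := SummationFilter.unconditional _), ← measure_iUnion hdisj fun j =>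
    (S.measurableSet_linked j).inter
      (measurableSet_lt (S.measurable_threshold j) (S.fading_measurable 0))]
  refine measure_congr ?_
  filter_upwards [S.ae_exists_mem_nearestSet, S.ae_norm_sat, S.ae_interferenceAt_nonneg]
    with ω ⟨j, hj⟩ hn hI
  refine propext ((S.lt_sinr_iff hn hI hj).trans ⟨fun h => mem_iUnion.2 ⟨j, h⟩, fun h => ?_⟩)
  obtain ⟨i, hi, hlt⟩ := mem_iUnion.1 h
  obtain rfl : i = j := net.pairwise_disjoint_nearestSet.eq (not_disjoint_iff.2 ⟨_, hi.1, hj⟩)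
  exact ⟨hi, hlt⟩

theorem setLIntegral_exp_threshold (j : Fin (net.numSat m)) (q : ℕ) :
    ∫⁻ ω in S.satConfig ⁻¹' net.linkedSet m j,
        ENNReal.ofReal (exp (-(q * net.fadingRate * S.threshold j ω))) ∂μ
      = ∫⁻ ω in S.satConfig ⁻¹' net.linkedSet m j,
        ENNReal.ofReal (exp (-(q * net.sLS m (S.contactAngle j ω) * net.noise)) *
          net.interferenceLT m (q * net.sLS m (S.contactAngle j ω))) ∂μ := by
  have := S.sat_indep.isProbabilityMeasure
  let s : (Fin (net.numSat m) → Space) → ℝ := fun x =>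
    q * net.sLS m (angle (x j) net.typicalDevice)
  have hs : Measurable s := ((net.measurable_sLS m).comp
    (net.measurable_angle_apply_typicalDevice j)).const_mul _
  have hs0 : ∀ x, 0 ≤ s x := fun x => mul_nonneg q.cast_nonneg (net.sLS_pos m _).le
  let f : (Fin (net.numSat m) → Space) → (ℕ × (ℕ → Space)) × (ℕ → ℝ) → ENNReal := fun x d =>
    ENNReal.ofReal (exp (-(s x * net.noise))) *
      ENNReal.ofReal (exp (-(s x * net.interferenceAt m (x j) d)))
  have hf : Measurable (Function.uncurry f) := by fun_prop
  have hsplit : ∀ ω, ENNReal.ofReal (exp (-(q * net.fadingRate * S.threshold j ω)))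
      = f (S.satConfig ω) (S.interferers ω) := fun ω => by
    simp only [f, s]
    rw [← ENNReal.ofReal_mul (exp_pos _).le, ← exp_add, threshold, Network.thresholdAt,
      net.sLS_eq]
    ring_nf
  simp_rw [hsplit]
  rw [setLIntegral_preimage_of_indepFun S.measurable_satConfig
    ⟨S.measurable_interferers.aemeasurable, rfl⟩ S.indepFun_satConfig_interferers
    (net.measurableSet_linkedSet j) hf]
  refine lintegral_congr_ae ?_
  filter_upwards [ae_restrict_of_ae S.ae_norm_sat] with ω hn
  rw [lintegral_const_mul _ (by fun_prop),
    S.lintegral_exp_neg_mul_interferenceAt (x := S.satConfig ω j) (hn j) (hs0 _),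
    ← ENNReal.ofReal_mul (exp_pos _).le]
  rfl

theorem integral_exp_thresholdMeasure (q : ℕ) :
    ∫ t, exp (-(q * net.fadingRate * t)) ∂S.thresholdMeasure
      = ∫ θ in (0 : ℝ)..(net.thetaMax m),
        exp (-(q * net.sLS m θ * net.noise)) *
          net.interferenceLT m (q * net.sLS m θ) * net.contactPDF m θ := by
  have hpdf := (net.continuous_contactPDF m).measurable
  rw [integral_eq_lintegral_of_nonneg_ae (ae_of_all _ fun t => (exp_pos _).le)
    (by fun_prop), S.lintegral_thresholdMeasure (by fun_prop)]
  simp_rw [S.setLIntegral_exp_threshold]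
  rw [S.sum_setLIntegral_linked (φ := fun θ => ENNReal.ofReal
      (exp (-(q * net.sLS m θ * net.noise)) * net.interferenceLT m (q * net.sLS m θ)))
      (by fun_prop),
    intervalIntegral.integral_of_le (net.thetaMax_pos m).le, integral_Ioc_eq_integral_Ioo,
    integral_eq_lintegral_of_nonneg_ae _ (by fun_prop)]
  · congr 1
    refine setLIntegral_congr_fun measurableSet_Ioo fun θ _ => ?_
    rw [mul_comm, ENNReal.ofReal_mul (mul_nonneg (exp_pos _).le (net.interferenceLT_pos m _).le)]
  · filter_upwards [ae_restrict_mem measurableSet_Ioo] with θ hθ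
    exact mul_nonneg (mul_nonneg (exp_pos _).le (net.interferenceLT_pos m _).le)
      (net.contactPDF_nonneg m ⟨hθ.1, hθ.2.trans (net.thetaMax_lt_pi m)⟩)

end Threshold

section Coverage

theorem integrable_one_sub_cdf : Integrable (fun t => 1 - cdf ν t) S.thresholdMeasure := by
  refine Integrable.of_bound (C := 1)
    (measurable_const.sub (cdf ν).mono.measurable).aestronglyMeasurable (ae_of_all _ fun t => ?_)
  rw [Real.norm_of_nonneg (sub_nonneg.2 (cdf_le_one ν t))]
  exact sub_le_self 1 (cdf_nonneg ν t)

theorem integrable_exp_thresholdMeasure {b : ℝ} (hb : 0 ≤ b) :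
    Integrable (fun t => exp (-(b * t))) S.thresholdMeasure := by
  refine Integrable.of_bound (C := 1) (by fun_prop) ?_
  filter_upwards [S.ae_thresholdMeasure_nonneg] with t ht
  rw [Real.norm_of_nonneg (exp_pos _).le]
  exact exp_le_one_iff.2 (neg_nonpos.2 (mul_nonneg hb ht))

theorem integrable_choose_mul_exp (q : ℕ) :
    Integrable (fun t => (net.m₁.choose q : ℝ) * (-1) ^ (q + 1) *
      exp (-(q * net.fadingRate * t))) S.thresholdMeasure :=
  (S.integrable_exp_thresholdMeasure
    (mul_nonneg q.cast_nonneg net.fadingRate_pos.le)).const_mul _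

theorem integrable_one_sub_approxCDF :
    Integrable (fun t => 1 - net.approxCDF t) S.thresholdMeasure := by
  simp_rw [net.one_sub_approxCDF]
  exact integrable_finsetSum _ fun q _ => S.integrable_choose_mul_exp q

theorem coverage_eq_integral [IsProbabilityMeasure ν] :
    S.coverage = ∫ t, (1 - cdf ν t) ∂S.thresholdMeasure := by
  rw [integral_eq_lintegral_of_nonneg_ae (ae_of_all _ fun t => sub_nonneg.2 (cdf_le_one ν t))
    (measurable_const.sub (cdf ν).mono.measurable).aestronglyMeasurable, coverage,
    measureReal_def, S.measure_covered]
  congr 1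
  refine lintegral_congr fun t => ?_
  rw [cdf_eq_real, ← probReal_compl_eq_one_sub measurableSet_Iic, compl_Iic, ofReal_measureReal]

theorem coverageFormula_eq_integral :
    net.coverageFormula m = ∫ t, (1 - net.approxCDF t) ∂S.thresholdMeasure := by
  simp_rw [net.one_sub_approxCDF]
  rw [integral_finsetSum _ fun q _ => S.integrable_choose_mul_exp q]
  refine Finset.sum_congr rfl fun q _ => ?_
  rw [integral_const_mul, S.integral_exp_thresholdMeasure]

variable [IsProbabilityMeasure ν]

theorem coverage_le_of_approxCDF_le (h : ∀ x, 0 ≤ x → net.approxCDF x ≤ cdf ν x) :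
    S.coverage ≤ net.coverageFormula m := by
  rw [S.coverage_eq_integral, S.coverageFormula_eq_integral]
  refine integral_mono_ae S.integrable_one_sub_cdf S.integrable_one_sub_approxCDF ?_
  filter_upwards [S.ae_thresholdMeasure_nonneg] with t ht
  exact sub_le_sub_left (h t ht) 1

theorem le_coverage_of_cdf_le (h : ∀ x, 0 ≤ x → cdf ν x ≤ net.approxCDF x) :
    net.coverageFormula m ≤ S.coverage := by
  rw [S.coverage_eq_integral, S.coverageFormula_eq_integral]
  refine integral_mono_ae S.integrable_one_sub_approxCDF S.integrable_one_sub_cdf ?_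
  filter_upwards [S.ae_thresholdMeasure_nonneg] with t ht
  exact sub_le_sub_left (h t ht) 1

theorem coverage_eq_of_cdf_eq (h : ∀ x, 0 ≤ x → cdf ν x = net.approxCDF x) :
    S.coverage = net.coverageFormula m :=
  le_antisymm (S.coverage_le_of_approxCDF_le fun x hx => (h x hx).ge)
    (S.le_coverage_of_cdf_le fun x hx => (h x hx).le)

theorem abs_coverage_sub_le {ε : ℝ} (h : ∀ x, 0 ≤ x → |cdf ν x - net.approxCDF x| ≤ ε) :
    |S.coverage - net.coverageFormula m| ≤ ε * net.availability m := by
  have hbound : ∀ᵐ t ∂S.thresholdMeasure, ‖1 - cdf ν t - (1 - net.approxCDF t)‖ ≤ ε := by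
    filter_upwards [S.ae_thresholdMeasure_nonneg] with t ht
    rw [sub_sub_sub_cancel_left, Real.norm_eq_abs, abs_sub_comm]
    exact h t ht
  have hint := norm_integral_le_of_norm_le_const hbound
  rwa [integral_sub S.integrable_one_sub_cdf S.integrable_one_sub_approxCDF,
    ← S.coverage_eq_integral, ← S.coverageFormula_eq_integral, Real.norm_eq_abs, measureReal_def,
    S.thresholdMeasure_univ, ENNReal.toReal_ofReal (net.availability_nonneg m)] at hint

end Coverage

end Uplink

end

end LEOUplink

theorem lemma4 {K : ℕ} (net : LEOUplink.Network K) (m : Fin K)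
    (ν : Measure ℝ) [IsProbabilityMeasure ν]
    {Ω : Type*} [MeasurableSpace Ω] (μ : Measure Ω) [IsProbabilityMeasure μ]
    (S : LEOUplink.Uplink net m ν μ) :
    ((∀ x, 0 ≤ x → cdf ν x = net.approxCDF x) → S.coverage = net.coverageFormula m) ∧
    (∀ ε : ℝ, (∀ x, 0 ≤ x → |cdf ν x - net.approxCDF x| ≤ ε) →
      |S.coverage - net.coverageFormula m| ≤ ε * net.availability m) ∧
    ((∀ x, 0 ≤ x → cdf ν x ≤ net.approxCDF x) → net.coverageFormula m ≤ S.coverage) ∧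
    ((∀ x, 0 ≤ x → net.approxCDF x ≤ cdf ν x) → S.coverage ≤ net.coverageFormula m) ∧
    (net.m₁ = 1 → ν = gammaMeasure (net.m₁ : ℝ) (1 / net.m₂) →
      S.coverage = net.coverageFormula m) := by
  refine ⟨S.coverage_eq_of_cdf_eq, fun ε => S.abs_coverage_sub_le, S.le_coverage_of_cdf_le,
    S.coverage_le_of_approxCDF_le, fun h1 hν => S.coverage_eq_of_cdf_eq fun x hx => ?_⟩
  rw [hν, net.cdf_gammaMeasure_eq_approxCDF h1 hx]
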